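/- **Proposition 4.8.** Complex spaces are Hausdorff. For a reduced complex space $X$ let $X_{reg}$ be the complex manifold of its nonsingular points, and let $\dim X$ be the largest dimension of a connected component of $X_{reg}$. The sheaf $\mathcal A^{p,q}_X$ of smooth $(p,q)$-forms on $X$ is defined by local embeddings: if an open set $U\subseteq X$ is embedded as an analytic subset, $i:U\to V$, of an open set $V\subseteq\mathbb C^N$, it is locally the quotient of the smooth $(p,q)$-forms on $V$ by those whose pullback to $U_{reg}$ vanishes; the exterior derivative $d$ is induced from $V$. A real $(p,p)$-form $\alpha$ on $\mathbb C^N$ (as a vector space, $p\le N$) is strictly positive if for all linearly independent $(1,0)$-forms $a_1,\dots,a_{N-p}$ one has $\alpha\wedge i^{(N-p)^2}a_1\wedge\dots\wedge a_{N-p}\wedge\overline{a_1}\wedge\dots\wedge\overline{a_{N-p}}=c\; i\,dz_1\wedge d\bar z_1\wedge\dots\wedge i\,dz_N\wedge d\bar z_N$ with $c>0$; a smooth form on an open subset of $\mathbb C^N$ is strictly positive if it is so at every point. A real $(p,p)$-form on $X$ is strictly positive if $X$ is covered by open sets $U$ with embeddings $i:U\to V$ into open sets $V$ of some $\mathbb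 C^N$ such that on $U$ the form is $i^*\omega$ for a smooth strictly positive $(p,p)$-form $\omega$ on $V$. An $n$-dimensional reduced complex space $X$ is called balanced if there is a $d$-closed strictly positive $(n-1,n-1)$-form on $X$ (for $n=0$ read $n-1$ as $0$). A local isomorphism $f:X\to Y$ of reduced complex spaces is a surjective holomorphic map such that every $x\in X$ has an open neighbourhood which $f$ maps isomorphically onto an open neighbourhood of $f(x)$. An unramified covering is a local isomorphism which is a topological covering map. Let $X$ and $Y$ be reduced compact complex spaces and let $f:X\to Y$ be a map. 1. If $f$ is a local isomorphism and $Y$ is balanced, then $X$ is balanced. 2. If $f$ is an unramified covering, then $X$ is balanced if and only if $Y$ is balanced. -/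

import Mathlib

open Set Filter Topology
open scoped ContDiff

noncomputable section

namespace BalancedSpace

/-! ### Reduced complex spaces -/

/-- Complex affine space `ℂ^N`. -/
abbrev CSpace (N : ℕ) : Type := Fin N → ℂ

/-- A sheaf of complex-valued functions on a topological space, given through its germs:
`HolAt g x` says that the germ of `g` at `x` belongs to the sheaf.  A function on an open set `U`
is a section over `U` iff it satisfies `HolAt` at every point of `U`. -/
class FunctionSheaf (X : Type*) [TopologicalSpace X] where
  /-- the germ of `g` at `x` is a germ of the sheaf -/
  HolAt : (X → ℂ) → X → Prop
  holAt_congr : ∀ {g h : X → ℂ} {x : X}, g =ᶠ[𝓝 x] h → HolAt g x → HolAt h x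
  holAt_eventually : ∀ {g : X → ℂ} {x : X}, HolAt g x → ∀ᶠ y in 𝓝 x, HolAt g y

open FunctionSheaf

/-- `ℂ^N` carries the sheaf of holomorphic functions. -/
instance instFunctionSheafCSpace (N : ℕ) : FunctionSheaf (CSpace N) where
  HolAt g z := AnalyticAt ℂ g z
  holAt_congr h hg := hg.congr h
  holAt_eventually hg := hg.eventually_analyticAt

/-- `A` is an analytic subset of the open set `V` in `ℂ^N`: near every point of `V` it is the
common zero set of finitely many holomorphic functions. -/
def IsAnalyticSubset {N : ℕ} (V A : Set (CSpace N)) : Prop :=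
  A ⊆ V ∧ ∀ a ∈ V, ∃ W : Set (CSpace N), IsOpen W ∧ a ∈ W ∧ W ⊆ V ∧
    ∃ (r : ℕ) (g : Fin r → CSpace N → ℂ), (∀ j, AnalyticOnNhd ℂ (g j) W) ∧
      A ∩ W = {z ∈ W | ∀ j, g j z = 0}

/-- A (closed) embedding `i : U → V` of an open subset `U` of `X` into an open subset `V` of `ℂ^N`:
a homeomorphism of `U` onto an analytic subset of `V`, under which the functions in the sheaf of
`X` are exactly those that extend locally to holomorphic functions on `ℂ^N`.
(The values of `toFun` outside of `source = U` play no role.) -/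
structure LocalEmbedding (X : Type*) [TopologicalSpace X] [FunctionSheaf X] (N : ℕ) where
  source : Set X
  target : Set (CSpace N)
  toFun : X → CSpace N
  isOpen_source : IsOpen source
  isOpen_target : IsOpen target
  isEmbedding : IsEmbedding (source.domRestrict toFun)
  isAnalyticSubset_image : IsAnalyticSubset target (toFun '' source)
  holAt_iff : ∀ x ∈ source, ∀ g : X → ℂ,
    HolAt g x ↔ ∃ G : CSpace N → ℂ, AnalyticAt ℂ G (toFun x) ∧ g =ᶠ[𝓝 x] G ∘ toFun

/-- A reduced complex space: a Hausdorff space with a sheaf of complex-valued functions which is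
locally isomorphic to an analytic subset of an open set in some `ℂ^N` with its (reduced) sheaf of
holomorphic functions. -/
class ReducedComplexSpace (X : Type*) [TopologicalSpace X] extends
    FunctionSheaf X, T2Space X where
  exists_localEmbedding : ∀ x : X, ∃ (N : ℕ) (i : LocalEmbedding X N), x ∈ i.source

/-- `f` restricts to an isomorphism (of spaces with a sheaf of functions) from the open set `U`
onto the open set `V`. -/
structure IsIsoOn {X Y : Type*} [TopologicalSpace X] [FunctionSheaf X] [TopologicalSpace Y]
    [FunctionSheaf Y] (f : X → Y) (U : Set X) (V : Set Y) : Prop where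
  isOpen_source : IsOpen U
  isOpen_target : IsOpen V
  bijOn : BijOn f U V
  isEmbedding : IsEmbedding (U.domRestrict f)
  holAt_iff : ∀ x ∈ U, ∀ g : Y → ℂ, HolAt g (f x) ↔ HolAt (g ∘ f) x

/-- A local isomorphism: a surjective map which, near every point, is an isomorphism of an open
neighbourhood onto an open subset (that is, a smooth morphism of relative dimension `0`). -/
def IsLocalIsomorphism {X Y : Type*} [TopologicalSpace X] [FunctionSheaf X] [TopologicalSpace Y]
    [FunctionSheaf Y] (f : X → Y) : Prop :=
  Function.Surjective f ∧
    ∀ x : X, ∃ (U : Set X) (V : Set Y), x ∈ U ∧ f x ∈ V ∧ IsIsoOn f U V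

/-- An unramified covering: a topological covering which is a local isomorphism. -/
def IsUnramifiedCovering {X Y : Type*} [TopologicalSpace X] [FunctionSheaf X] [TopologicalSpace Y]
    [FunctionSheaf Y] (f : X → Y) : Prop :=
  IsCoveringMap f ∧ IsLocalIsomorphism f

/-! ### Nonsingular points and dimension -/

/-- A parametrization of an open set of nonsingular points: an isomorphism from an open subset
`source` of `ℂ^m` onto an open subset of `X`.  The nonsingular points of `X` are the points in the
images of such parametrizations, and `X_reg` is the set of these points. -/
structure RegularParam (X : Type*) [TopologicalSpace X] [FunctionSheaf X] (m : ℕ) where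
  source : Set (CSpace m)
  toFun : CSpace m → X
  isIsoOn : IsIsoOn toFun source (toFun '' source)

/-- `X` has dimension `n`: `n` is the largest of the dimensions of the connected components of the
manifold `X_reg` of nonsingular points. -/
def HasDimension (X : Type*) [TopologicalSpace X] [FunctionSheaf X] (n : ℕ) : Prop :=
  IsGreatest {m : ℕ | ∃ φ : RegularParam X m, φ.source.Nonempty} n

/-! ### Multilinear algebra: complex-valued alternating forms on `ℂ^N` -/

/-- A form `α` of degree `k` is of type `(p, q)` iff `p + q = k` and
`α (λ v₁, …, λ v_k) = λ ^ p * conj λ ^ q * α (v₁, …, v_k)` for all complex `λ`. -/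
def IsOfType {N k : ℕ} (p q : ℕ) (α : CSpace N [⋀^Fin k]→L[ℝ] ℂ) : Prop :=
  p + q = k ∧ ∀ (c : ℂ) (v : Fin k → CSpace N),
    α (fun j => c • v j) = c ^ p * (starRingEnd ℂ c) ^ q * α v

/-- A complex-valued form is real if it takes real values (that is, it equals its conjugate). -/
def IsRealForm {N k : ℕ} (α : CSpace N [⋀^Fin k]→L[ℝ] ℂ) : Prop :=
  ∀ v : Fin k → CSpace N, starRingEnd ℂ (α v) = α v

/-- The wedge product of two complex-valued alternating forms. -/
def wedge {E : Type*} [AddCommGroup E] [Module ℝ E] {k l : ℕ}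
    (α : E [⋀^Fin k]→ₗ[ℝ] ℂ) (β : E [⋀^Fin l]→ₗ[ℝ] ℂ) : E [⋀^Fin (k + l)]→ₗ[ℝ] ℂ :=
  ((LinearMap.mul' ℝ ℂ).compAlternatingMap (AlternatingMap.domCoprod α β)).domDomCongr
    finSumFinEquiv

/-- The wedge product `a₁ ∧ … ∧ a_k` of 1-forms,
`(v₁, …, v_k) ↦ ∑ σ, sign σ * a₁ (v_{σ 1}) ⋯ a_k (v_{σ k}) = det (a_i (v_j))`. -/
def wedgeOneForms {E : Type*} [AddCommGroup E] [Module ℝ E] {k : ℕ}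
    (a : Fin k → (E →ₗ[ℝ] ℂ)) : E [⋀^Fin k]→ₗ[ℝ] ℂ :=
  MultilinearMap.alternatization ((MultilinearMap.mkPiAlgebra ℝ (Fin k) ℂ).compLinearMap a)

/-- The conjugate of a complex-valued 1-form. -/
def conjOneForm {E : Type*} [AddCommGroup E] [Module ℝ E] (a : E →ₗ[ℝ] ℂ) : E →ₗ[ℝ] ℂ :=
  Complex.conjAe.toLinearMap ∘ₗ a

/-- The coordinate form `dz_j` on `ℂ^N`, as a real-linear map. -/
def dz {N : ℕ} (j : Fin N) : CSpace N →ₗ[ℝ] ℂ :=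
  (LinearMap.proj j : CSpace N →ₗ[ℂ] ℂ).restrictScalars ℝ

/-- The volume form `i dz₁ ∧ dz̄₁ ∧ … ∧ i dz_N ∧ dz̄_N` on `ℂ^N`. -/
def stdVolume (N : ℕ) : CSpace N [⋀^Fin (N * 2)]→ₗ[ℝ] ℂ :=
  wedgeOneForms fun s =>
    if s.modNat = 0 then Complex.I • dz s.divNat else conjOneForm (dz s.divNat)

/-- `η` is a strictly positive volume form: a form of top degree equal to
`c • (i dz₁ ∧ dz̄₁ ∧ … ∧ i dz_N ∧ dz̄_N)` with `c > 0`. -/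
def IsStrictlyPositiveVolume {N m : ℕ} (η : CSpace N [⋀^Fin m]→ₗ[ℝ] ℂ) : Prop :=
  ∃ (h : m = N * 2) (c : ℝ), 0 < c ∧ η.domDomCongr (finCongr h) = c • stdVolume N

/-- The form `i ^ (r ^ 2) a₁ ∧ … ∧ a_r ∧ ā₁ ∧ … ∧ ā_r` for `(1, 0)`-forms `a₁, …, a_r`. -/
def elementaryForm {N r : ℕ} (a : Fin r → (CSpace N →ₗ[ℂ] ℂ)) :
    CSpace N [⋀^Fin (r + r)]→ₗ[ℝ] ℂ :=
  Complex.I ^ (r ^ 2) •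
    wedge (wedgeOneForms fun j => (a j).restrictScalars ℝ)
      (wedgeOneForms fun j => conjOneForm ((a j).restrictScalars ℝ))

/-- `α` is a strictly positive `(p, p)`-form on the vector space `ℂ^N`: it is real, of type
`(p, p)`, and with `r = N - p` the product `α ∧ i ^ (r ^ 2) a₁ ∧ … ∧ a_r ∧ ā₁ ∧ … ∧ ā_r` is a
strictly positive volume form for all linearly independent `(1, 0)`-forms `a₁, …, a_r`. -/
def IsStrictlyPositiveForm {N : ℕ} (p : ℕ) (α : CSpace N [⋀^Fin (p + p)]→L[ℝ] ℂ) : Prop :=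
  IsRealForm α ∧ IsOfType p p α ∧ ∃ r : ℕ, p + r = N ∧
    ∀ a : Fin r → (CSpace N →ₗ[ℂ] ℂ), LinearIndependent ℂ a →
      IsStrictlyPositiveVolume (wedge α.toAlternatingMap (elementaryForm a))

/-! ### Differential forms on reduced complex spaces -/

/-- The pullback of a differential form `θ` on (an open subset of) `ℂ^N` under
`h : ℂ^m → ℂ^N`. -/
def pullback {m N k : ℕ} (h : CSpace m → CSpace N)
    (θ : CSpace N → CSpace N [⋀^Fin k]→L[ℝ] ℂ) (t : CSpace m) : CSpace m [⋀^Fin k]→L[ℝ] ℂ :=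
  (θ (h t)).compContinuousLinearMap (fderiv ℝ h t)

/-- A family `η` of forms in the parametrizations of `X_reg` is, over the source of the local
embedding `i`, the restriction to `X_reg` of the form `θ` on the target of `i`. -/
def IsRestriction {X : Type*} [TopologicalSpace X] [FunctionSheaf X] {N k : ℕ}
    (η : ∀ m : ℕ, RegularParam X m → CSpace m → CSpace m [⋀^Fin k]→L[ℝ] ℂ)
    (i : LocalEmbedding X N) (θ : CSpace N → CSpace N [⋀^Fin k]→L[ℝ] ℂ) : Prop :=
  ∀ (m : ℕ) (φ : RegularParam X m), ∀ t ∈ φ.source, φ.toFun t ∈ i.source →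
    η m φ t = pullback (i.toFun ∘ φ.toFun) θ t

/-- A smooth complex-valued differential form of degree `k` on `X`: a global section of the sheaf
which is locally, for an embedding of an open set `U` of `X` into an open set `V` of `ℂ^N`, the
quotient of the smooth forms on `V` by those whose pullback to `U_reg` vanishes.  By this definition
a section is determined by its restriction to `X_reg`, and the forms on `X_reg` which arise are
those that near every point of `X` (singular or not) are restricted from smooth forms on `V`.
The form on `X_reg` is recorded by its expression `val m φ` in each parametrization `φ` of an open
subset of `X_reg` (only the values on `φ.source` matter). -/
structure SmoothForm (X : Type*) [TopologicalSpace X] [FunctionSheaf X] (k : ℕ) where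
  val : ∀ m : ℕ, RegularParam X m → CSpace m → CSpace m [⋀^Fin k]→L[ℝ] ℂ
  exists_extension : ∀ x : X, ∃ (N : ℕ) (i : LocalEmbedding X N), x ∈ i.source ∧
    ∃ θ : CSpace N → CSpace N [⋀^Fin k]→L[ℝ] ℂ, ContDiffOn ℝ ∞ θ i.target ∧
      IsRestriction val i θ

namespace SmoothForm

variable {X : Type*} [TopologicalSpace X] [FunctionSheaf X] {k : ℕ}

/-- The form is closed, `dΩ = 0` (as a form on `X`, hence tested on `X_reg`). -/
def IsClosed (Ω : SmoothForm X k) : Prop :=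
  ∀ (m : ℕ) (φ : RegularParam X m), ∀ t ∈ φ.source, extDeriv (Ω.val m φ) t = 0

/-- The form is of type `(p, q)`. -/
def IsOfType (p q : ℕ) (Ω : SmoothForm X k) : Prop :=
  ∀ (m : ℕ) (φ : RegularParam X m), ∀ t ∈ φ.source, BalancedSpace.IsOfType p q (Ω.val m φ t)

/-- The form is real. -/
def IsReal (Ω : SmoothForm X k) : Prop :=
  ∀ (m : ℕ) (φ : RegularParam X m), ∀ t ∈ φ.source, IsRealForm (Ω.val m φ t)

/-- A `(p, p)`-form on `X` is strictly positive if it is real and `X` is covered by open sets `U`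
with embeddings `i` into open sets `V` of some `ℂ^N` such that on `U` the form is the restriction of
a smooth form on `V` which is a strictly positive `(p, p)`-form at every point of `V`. -/
def IsStrictlyPositive (p : ℕ) (Ω : SmoothForm X (p + p)) : Prop :=
  Ω.IsReal ∧ Ω.IsOfType p p ∧ ∀ x : X, ∃ (N : ℕ) (i : LocalEmbedding X N), x ∈ i.source ∧
    ∃ θ : CSpace N → CSpace N [⋀^Fin (p + p)]→L[ℝ] ℂ, ContDiffOn ℝ ∞ θ i.target ∧
      (∀ z ∈ i.target, IsStrictlyPositiveForm p (θ z)) ∧ IsRestriction Ω.val i θ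

end SmoothForm

/-- A reduced complex space of dimension `n` is balanced if it carries a closed strictly positive
`(n - 1, n - 1)`-form.  (For `n = 0` this is read with `n - 1 = 0`, and then always holds.) -/
def IsBalanced (X : Type*) [TopologicalSpace X] [ReducedComplexSpace X] : Prop :=
  ∃ n : ℕ, HasDimension X n ∧
    ∃ Ω : SmoothForm X ((n - 1) + (n - 1)), Ω.IsClosed ∧ Ω.IsStrictlyPositive (n - 1)

end BalancedSpace

end

/-! ### Alternating forms on complex frames: determinants and signs. -/

open Set Filter Topology
open scoped ContDiff

noncomputable section

namespace BalancedSpace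

/-! Pulling back is a local matter. A local isomorphism turns an embedding of an open piece of `Y`
into an embedding of an open piece of `X` with the same ambient form, so closedness, type and strict
positivity all pass to `SmoothForm.comap`. The dimensions agree because parametrizations of
nonsingular points can be carried in both directions.

For the converse the form is pushed down: `traceVal` sums, over a fibre, the pullbacks under the
local inverses of `f`. Compactness of `X` makes the fibres finite, and nearby fibres are obtained by
moving the points of one fibre along local sections (`exists_fiber_nhds`). Near each point the trace
is thus a finite sum of closed real `(p, p)`-forms.

The difficulty is strict positivity, since the summands extend to different ambient spaces. Fix one
point `a` of the fibre and embed `Y` near `y` by the embedding at `a`. The embedding at any other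
point `x` of the fibre is then locally this one followed by a holomorphic map `h x` of ambient
spaces, so the trace extends as `θ a` plus the pullbacks of the `θ x` under `h x`
(`exists_trace_restriction`). Those pullbacks are only semipositive, as `h x` may have a degenerate
derivative, but `θ a` makes the sum strictly positive.

The definition of positivity by wedging with `N - p` forms is ill suited to pullbacks, as it depends
on `N`. It is replaced by the criterion that `α` be positive on `(v₁, i v₁, …, v_p, i v_p)` for all
independent `v` (`isStrictlyPositiveForm_iff`), which complex linear maps visibly respect, up to
degeneration to zero. -/

theorem wedgeOneForms_apply {E : Type*} [AddCommGroup E] [Module ℝ E] {k : ℕ}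
    (a : Fin k → (E →ₗ[ℝ] ℂ)) (w : Fin k → E) :
    wedgeOneForms a w = (Matrix.of fun i j => a i (w j)).det := by
  rw [← Matrix.det_transpose, Matrix.det_apply, wedgeOneForms,
    MultilinearMap.alternatization_apply]
  simp

/-- The product of two alternatizations, summed over shuffles, is the alternatization of the
product, which gives the Leibniz formula without factorials. -/
theorem wedge_wedgeOneForms_apply {E : Type*} [AddCommGroup E] [Module ℝ E] {k l : ℕ}
    (a : Fin k → (E →ₗ[ℝ] ℂ)) (b : Fin l → (E →ₗ[ℝ] ℂ)) (w : Fin k ⊕ Fin l → E) :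
    wedge (wedgeOneForms a) (wedgeOneForms b) (w ∘ finSumFinEquiv.symm) =
      (Matrix.of fun i j => Sum.elim a b i (w j)).det := by
  rw [← Matrix.det_transpose, Matrix.det_apply, wedge, wedgeOneForms, wedgeOneForms,
    ← MultilinearMap.domCoprod_alternization]
  rw [AlternatingMap.domDomCongr_apply, LinearMap.compAlternatingMap_apply,
    MultilinearMap.alternatization_apply, map_sum]
  refine Finset.sum_congr rfl fun σ _ => ?_
  rcases Int.units_eq_one_or (Equiv.Perm.sign σ) with h | h <;>
    simp [Fintype.prod_sum_type, MultilinearMap.domCoprod_apply, h]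

/-- In the sum over shuffles every class except that of the identity feeds some `v j` to `β`, and so
vanishes. -/
theorem wedge_apply_of_vanish {E : Type*} [AddCommGroup E] [Module ℝ E] {k l : ℕ}
    (α : E [⋀^Fin k]→ₗ[ℝ] ℂ) (β : E [⋀^Fin l]→ₗ[ℝ] ℂ) (v : Fin k → E) (u : Fin l → E)
    (hβ : ∀ w : Fin l → E, (∃ i j, w i = v j) → β w = 0) :
    wedge α β (Sum.elim v u ∘ finSumFinEquiv.symm) = α v * β u := by
  rw [wedge, AlternatingMap.domDomCongr_apply, LinearMap.compAlternatingMap_apply,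
    AlternatingMap.domCoprod_apply, sum_apply, map_sum]
  refine (Fintype.sum_eq_single
    (Quotient.mk'' 1 : Equiv.Perm.ModSumCongr (Fin k) (Fin l)) ?_).trans ?_
  · intro σ hσ
    induction σ using Quotient.inductionOn' with
    | h σ =>
    by_cases h : ∃ i j, σ (Sum.inr i) = Sum.inl j
    · obtain ⟨i, j, hij⟩ := h
      rw [AlternatingMap.domCoprod.summand_mk'']
      have : β (fun i => Sum.elim v u (σ (Sum.inr i))) = 0 :=
        hβ _ ⟨i, j, by simp [hij]⟩
      simp [MultilinearMap.domCoprod_apply, this]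
    · exfalso
      apply hσ
      push Not at h
      -- A permutation that sends nothing from the right block to the left one preserves both
      -- blocks, hence lies in the class of the identity.
      have hr : MapsTo ⇑σ⁻¹ (range (Sum.inl : Fin k → Fin k ⊕ Fin l)) (range Sum.inl) := by
        rintro _ ⟨i, rfl⟩
        rcases hs : σ⁻¹ (Sum.inl i) with j | j
        · exact ⟨j, rfl⟩
        · rw [Equiv.Perm.inv_eq_iff_eq] at hs
          exact absurd hs.symm (h j i)
      have := Equiv.Perm.mem_sumCongrHom_range_of_perm_mapsTo_inl hr
      refine Quotient.sound' ?_
      rw [QuotientGroup.leftRel_apply]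
      simpa using this
  · rw [AlternatingMap.domCoprod.summand_mk'']
    simp [MultilinearMap.domCoprod_apply]

/-- Blocks `(1, …, r, 1, …, r)` interleaved as `(1, 1, 2, 2, …, r, r)`. -/
def interleave (r : ℕ) : Fin r ⊕ Fin r ≃ Fin (r * 2) where
  toFun := Sum.elim (fun j => ⟨2 * j, by omega⟩) (fun j => ⟨2 * j + 1, by omega⟩)
  invFun s := if s.modNat = 0 then Sum.inl s.divNat else Sum.inr s.divNat
  left_inv := by
    rintro (j | j)
    · simp [Fin.modNat, Fin.divNat]
    · have : (2 * (j : ℕ) + 1) / 2 = j := by omega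
      simp [Fin.modNat, Fin.divNat, this]
  right_inv := by
    intro s
    by_cases h : (s : ℕ) % 2 = 0
    · simp [Fin.modNat, Fin.divNat, Fin.ext_iff, h]; omega
    · simp [Fin.modNat, Fin.divNat, Fin.ext_iff, h]; omega

theorem interleave_symm_apply {r : ℕ} (s : Fin (r * 2)) :
    (interleave r).symm s = if s.modNat = 0 then Sum.inl s.divNat else Sum.inr s.divNat := rfl

/-- The permutation of `Fin (r + r)` given by interleaving two blocks. -/
def interleavePerm (r : ℕ) : Equiv.Perm (Fin (r + r)) :=
  finSumFinEquiv.symm.trans ((interleave r).trans (finCongr (by omega)))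

/-- Count inversions: they occur only between `i` in the first block and `j` in the second with `j <
i`, and `0 + 1 + … + (r - 1) = r (r - 1) / 2`. -/
theorem sign_interleavePerm (r : ℕ) :
    Equiv.Perm.sign (interleavePerm r) = (-1) ^ (r * (r - 1) / 2) := by
  have h1 : ∀ i : Fin r, (interleavePerm r (Fin.castAdd r i) : ℕ) = 2 * i := by
    intro i; simp [interleavePerm, interleave]
  have h2 : ∀ i : Fin r, (interleavePerm r (Fin.natAdd r i) : ℕ) = 2 * i + 1 := by
    intro i; simp [interleavePerm, interleave, -Fin.natAdd_eq_addNat]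
  have h : ∀ i j : Fin (r + r), (if i < j then if interleavePerm r i < interleavePerm r j
      then (1 : ℤˣ) else -1 else 1) = if i < j ∧ (interleavePerm r j : ℕ) < interleavePerm r i
      then -1 else 1 := by
    intro i j
    by_cases hij : i < j
    · have : (interleavePerm r i : ℕ) ≠ interleavePerm r j := by
        intro h
        exact hij.ne ((interleavePerm r).injective (Fin.ext h))
      simp only [hij, Fin.lt_def, if_true, true_and]
      split_ifs <;> first | rfl | omega
    · simp [hij]
  rw [Equiv.Perm.sign_eq_prod_prod_Ioi]
  have : ∀ i : Fin (r + r), Finset.Ioi i = Finset.univ.filter (fun j => i < j) := by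
    intro i; ext; simp
  simp_rw [this, Finset.prod_filter, h]
  simp_rw [Fin.prod_univ_add, h1, h2]
  have e1 : ∀ i j : Fin r, ¬ (Fin.castAdd r i < Fin.castAdd r j ∧ 2 * (j : ℕ) < 2 * i) := by
    intro i j; simp only [Fin.lt_def, Fin.val_castAdd]; omega
  have e2 : ∀ i j : Fin r, (Fin.castAdd r i < Fin.natAdd r j ∧ 2 * (j : ℕ) + 1 < 2 * i) ↔
      j < i := by
    intro i j; simp only [Fin.lt_def, Fin.val_castAdd, Fin.val_natAdd]; omega
  have e3 : ∀ i j : Fin r, ¬ (Fin.natAdd r i < Fin.castAdd r j ∧ 2 * (j : ℕ) < 2 * i + 1) := by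
    intro i j; simp only [Fin.lt_def, Fin.val_castAdd, Fin.val_natAdd]; omega
  have e4 : ∀ i j : Fin r, ¬ (Fin.natAdd r i < Fin.natAdd r j ∧
      2 * (j : ℕ) + 1 < 2 * i + 1) := by
    intro i j; simp only [Fin.lt_def, Fin.val_natAdd]; omega
  simp only [e1, e2, e3, e4, if_false, Finset.prod_const_one, one_mul, mul_one]
  have e5 : ∀ i : Fin r, (∏ j : Fin r, if j < i then (-1 : ℤˣ) else 1) = (-1) ^ (i : ℕ) := by
    intro i
    rw [← Finset.prod_filter, Finset.prod_const]
    congr 1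
    have : Finset.univ.filter (fun j => j < i) = Finset.Iio i := by ext; simp
    rw [this, Fin.card_Iio]
  simp_rw [e5]
  rw [Finset.prod_pow_eq_pow_sum, Fin.sum_univ_eq_sum_range (fun i => i), Finset.sum_range_id]

/-- The real frame `(w₁, i w₁, …, w_N, i w_N)`. -/
def realFrame {E : Type*} [AddCommGroup E] [Module ℂ E] {N : ℕ} (w : Fin N → E) :
    Fin (N * 2) → E :=
  Sum.elim w (fun j => Complex.I • w j) ∘ (interleave N).symm

/-- The real frame `(w₁, i w₁, …, w_p, i w_p)`, indexed by `Fin (p + p)`. -/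
def doubleFrame {E : Type*} [AddCommGroup E] [Module ℂ E] {p : ℕ} (w : Fin p → E) :
    Fin (p + p) → E :=
  realFrame w ∘ finCongr (mul_two p).symm

/-- This is the matrix of the forms `a, ā` on the vectors `w, i w`. It factors as the block diagonal
matrix of `A` and its conjugate times a constant matrix of determinant `(-2i) ^ N`. -/
theorem det_fromBlocks_conj {N : ℕ} (A : Matrix (Fin N) (Fin N) ℂ) :
    (Matrix.fromBlocks A (Complex.I • A) (A.map (starRingEnd ℂ))
      (-Complex.I • A.map (starRingEnd ℂ))).det =
      (-2 * Complex.I) ^ N * (Complex.normSq A.det : ℂ) := by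
  have h : Matrix.fromBlocks A (Complex.I • A) (A.map (starRingEnd ℂ))
      (-Complex.I • A.map (starRingEnd ℂ)) =
      Matrix.fromBlocks A 0 0 (A.map (starRingEnd ℂ)) *
        Matrix.fromBlocks 1 (Complex.I • 1) 1 (-Complex.I • 1) := by
    simp [Matrix.fromBlocks_multiply]
  have h2 : (-Complex.I • (1 : Matrix (Fin N) (Fin N) ℂ) - 1 * (Complex.I • 1)) =
      (-2 * Complex.I) • 1 := by
    rw [one_mul, ← sub_smul]; congr 1; ring
  rw [h, Matrix.det_mul, Matrix.det_fromBlocks_zero₂₁, Matrix.det_fromBlocks_one₁₁, h2,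
    Matrix.det_smul, Matrix.det_one, Complex.normSq_eq_conj_mul_self]
  have : (A.map (starRingEnd ℂ)).det = starRingEnd ℂ A.det := by
    rw [RingHom.map_det]; rfl
  rw [this]
  simp
  ring

theorem stdVolume_realFrame {N : ℕ} (w : Fin N → CSpace N) :
    stdVolume N (realFrame w) =
      ((2 ^ N * Complex.normSq (Matrix.of fun i j => w j i).det : ℝ) : ℂ) := by
  set A : Matrix (Fin N) (Fin N) ℂ := Matrix.of fun i j => w j i with hA
  rw [stdVolume, wedgeOneForms_apply, ← Matrix.det_submatrix_equiv_self (interleave N)]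
  have h : (Matrix.submatrix (Matrix.of fun i j : Fin (N * 2) =>
      (if i.modNat = 0 then Complex.I • dz i.divNat else conjOneForm (dz i.divNat) :
        CSpace N →ₗ[ℝ] ℂ) (realFrame w j)) (interleave N) (interleave N)) =
      Matrix.fromBlocks (Complex.I • 1) 0 0 1 *
      Matrix.fromBlocks A (Complex.I • A) (A.map (starRingEnd ℂ))
        (-Complex.I • A.map (starRingEnd ℂ)) := by
    have hrow : ∀ s : Fin (N * 2), (if s.modNat = 0 then Complex.I • dz s.divNat
        else conjOneForm (dz s.divNat) : CSpace N →ₗ[ℝ] ℂ) =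
        Sum.elim (fun j => Complex.I • dz j) (fun j => conjOneForm (dz j))
          ((interleave N).symm s) := by
      intro s
      rw [interleave_symm_apply]
      split_ifs <;> rfl
    simp only [hrow]
    ext (i | i) (j | j) <;>
      simp [realFrame, Matrix.fromBlocks_multiply, hA, dz, conjOneForm]
  rw [h, Matrix.det_mul, det_fromBlocks_conj, Matrix.det_fromBlocks_zero₂₁]
  simp only [Matrix.det_smul, Matrix.det_one, Fintype.card_fin, mul_one]
  rw [← mul_assoc, ← mul_pow]
  have : Complex.I * (-2 * Complex.I) = 2 := by
    linear_combination (-2) * Complex.I_mul_I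
  rw [this]
  push_cast
  ring

theorem elementaryForm_sumElim {N r : ℕ} (a : Fin r → (CSpace N →ₗ[ℂ] ℂ))
    (u : Fin r → CSpace N) :
    elementaryForm a (Sum.elim u (fun j => Complex.I • u j) ∘ finSumFinEquiv.symm) =
      Complex.I ^ (r ^ 2) * ((-2 * Complex.I) ^ r *
        (Complex.normSq (Matrix.of fun i j => a i (u j)).det : ℂ)) := by
  rw [elementaryForm, AlternatingMap.smul_apply, wedge_wedgeOneForms_apply, smul_eq_mul,
    ← det_fromBlocks_conj]
  congr 2
  ext (i | i) (j | j) <;> simp [conjOneForm]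

/-- This is where the factor `i ^ (r ^ 2)` earns its place: it equals `i ^ r * (-1) ^ (r (r - 1) /
2)`, whose sign cancels that of the interleaving, while `i ^ r * (-2i) ^ r = 2 ^ r`. -/
theorem elementaryForm_doubleFrame {N r : ℕ} (a : Fin r → (CSpace N →ₗ[ℂ] ℂ))
    (u : Fin r → CSpace N) :
    elementaryForm a (doubleFrame u) =
      ((2 ^ r * Complex.normSq (Matrix.of fun i j => a i (u j)).det : ℝ) : ℂ) := by
  have h : doubleFrame u = (Sum.elim u (fun j => Complex.I • u j) ∘ finSumFinEquiv.symm) ∘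
      ⇑(interleavePerm r)⁻¹ := by
    rw [Equiv.Perm.inv_def]
    ext s
    simp [doubleFrame, realFrame, interleavePerm]
  rw [h, AlternatingMap.map_perm, Equiv.Perm.sign_inv, sign_interleavePerm,
    elementaryForm_sumElim]
  obtain ⟨t, ht⟩ := (Nat.even_mul_pred_self r)
  have ht2 : r * (r - 1) / 2 = t := by omega
  have hr : r ^ 2 = r + 2 * t := by
    cases r with
    | zero => simp at ht ⊢; omega
    | succ n => simp at ht; nlinarith
  rw [ht2, hr, pow_add, pow_mul, Complex.I_sq, Units.smul_def]
  have h1 : ((-1 : ℂ) ^ t) * (-1) ^ t = 1 := by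
    rw [← mul_pow]; simp
  have h2 : Complex.I ^ r * (-2 * Complex.I) ^ r = 2 ^ r := by
    rw [← mul_pow]; congr 1
    linear_combination (-2) * Complex.I_mul_I
  simp only [Units.val_pow_eq_pow_val, Units.val_neg, Units.val_one, zsmul_eq_mul]
  push_cast
  linear_combination (2 ^ r * (Complex.normSq (Matrix.of fun i j => a i (u j)).det : ℂ)) * h1 +
    (-1) ^ t * (-1) ^ t * (Complex.normSq (Matrix.of fun i j => a i (u j)).det : ℂ) * h2

/-- The real frame of a complex basis is a real basis, and a form of top degree is determined by its
value on one basis. -/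
theorem top_form_eq_smul {N : ℕ} {w : Fin N → CSpace N} (hw : LinearIndependent ℂ w)
    {η ζ : CSpace N [⋀^Fin (N * 2)]→ₗ[ℝ] ℂ} {c : ℝ}
    (h : η (realFrame w) = c * ζ (realFrame w)) : η = c • ζ := by
  set b := Module.Basis.mk hw (hw.span_eq_top_of_card_eq_finrank' (by simp)).ge with hb
  let e : Fin 2 × Fin N ≃ Fin (N * 2) :=
    ((finTwoEquiv.prodCongr (Equiv.refl _)).trans (Equiv.boolProdEquivSum _)).trans (interleave N)
  let B := (Complex.basisOneI.smulTower b).reindex e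
  have hB : ⇑B = realFrame w := by
    ext1 s
    obtain ⟨⟨i, j⟩, rfl⟩ := e.surjective s
    fin_cases i <;>
      simp [B, e, realFrame, hb, Equiv.boolProdEquivSum, Module.Basis.smulTower_apply, finTwoEquiv]
  refine B.ext_alternating fun v hv => ?_
  obtain ⟨σ, rfl⟩ : ∃ σ : Equiv.Perm (Fin (N * 2)), ⇑σ = v :=
    ⟨Equiv.ofBijective v (Finite.injective_iff_bijective.1 hv), rfl⟩
  rw [hB]
  change η (realFrame w ∘ σ) = (c • ζ) (realFrame w ∘ σ)
  rw [AlternatingMap.map_perm, AlternatingMap.map_perm, h]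
  simp

theorem stdVolume_realFrame_pos {N : ℕ} {w : Fin N → CSpace N} (hw : LinearIndependent ℂ w) :
    0 < Complex.normSq (Matrix.of fun i j => w j i).det := by
  rw [Complex.normSq_pos]
  have : LinearIndependent ℂ (Matrix.of fun i j => w j i : Matrix (Fin N) (Fin N) ℂ).col := hw
  rw [Matrix.linearIndependent_cols_iff_isUnit, Matrix.isUnit_iff_isUnit_det] at this
  exact this.ne_zero

theorem realFrame_apply {E : Type*} [AddCommGroup E] [Module ℂ E] {N : ℕ} (w : Fin N → E)
    (s : Fin (N * 2)) :
    realFrame w s = if (s : ℕ) % 2 = 0 then w s.divNat else Complex.I • w s.divNat := by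
  simp only [realFrame, Function.comp_apply, interleave_symm_apply, Fin.modNat, Fin.ext_iff]
  simp only [Fin.val_zero]
  split_ifs <;> rfl

theorem doubleFrame_apply {E : Type*} [AddCommGroup E] [Module ℂ E] {N : ℕ} (w : Fin N → E)
    (s : Fin (N + N)) :
    doubleFrame w s = if (s : ℕ) % 2 = 0 then w ⟨s / 2, by omega⟩
      else Complex.I • w ⟨s / 2, by omega⟩ := by
  rw [doubleFrame, Function.comp_apply, realFrame_apply]
  rfl

/-- Each vector stands next to its multiple by `i`, so real frames concatenate without any
reordering and no sign appears. -/
theorem realFrame_append {E : Type*} [AddCommGroup E] [Module ℂ E] {p r : ℕ}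
    (v : Fin p → E) (u : Fin r → E) (h : (p + p) + (r + r) = (p + r) * 2) :
    realFrame (Fin.append v u) ∘ finCongr h =
      Sum.elim (doubleFrame v) (doubleFrame u) ∘ finSumFinEquiv.symm := by
  ext1 s
  obtain ⟨s, rfl⟩ := finSumFinEquiv.surjective s
  rw [Function.comp_apply, Function.comp_apply, Equiv.symm_apply_apply, realFrame_apply]
  rcases s with s | s
  · have : (finCongr h (finSumFinEquiv (Sum.inl s))).divNat =
        Fin.castAdd r ⟨(s : ℕ) / 2, by omega⟩ := by
      ext; simp [Fin.divNat]
    rw [this, Fin.append_left, Sum.elim_inl, doubleFrame_apply]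
    simp
  · have : (finCongr h (finSumFinEquiv (Sum.inr s))).divNat =
        Fin.natAdd p ⟨(s : ℕ) / 2, by omega⟩ := by
      ext; simp [Fin.divNat, -Fin.natAdd_eq_addNat]; omega
    rw [this, Fin.append_right, Sum.elim_inr, doubleFrame_apply]
    have : (finCongr h (finSumFinEquiv (Sum.inr s)) : ℕ) % 2 = (s : ℕ) % 2 := by
      simp [-Fin.natAdd_eq_addNat]; omega
    rw [this]

theorem elementaryForm_eq_zero {N r : ℕ} (a : Fin r → (CSpace N →ₗ[ℂ] ℂ)) (w : Fin (r + r) → CSpace N)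
    {i : Fin (r + r)} (h : ∀ j, a j (w i) = 0) : elementaryForm a w = 0 := by
  have hw : w = (w ∘ finSumFinEquiv) ∘ finSumFinEquiv.symm := by ext; simp
  rw [elementaryForm, AlternatingMap.smul_apply, hw, wedge_wedgeOneForms_apply,
    Matrix.det_eq_zero_of_column_eq_zero (finSumFinEquiv.symm i), smul_zero]
  rintro (j | j) <;> simp [conjOneForm, h]

/-! ### Strict positivity tested on complex subspaces. -/

/-- Evaluate both sides on the real frame of `(v, u)`. As the `v j` span directions killed by every
`a i`, the wedge collapses to `α` on the frame of `v` times `2 ^ r`; the volume form gives `2 ^ (p +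
r) * D` with `D > 0` the squared modulus of the determinant of the frame. Hence `K = 2 ^ p * D`. -/
theorem wedge_elementaryForm_eq_smul_iff {p r : ℕ} {v : Fin p → CSpace (p + r)}
    {u : Fin r → CSpace (p + r)} (hvu : LinearIndependent ℂ (Fin.append v u))
    {a : Fin r → (CSpace (p + r) →ₗ[ℂ] ℂ)} (hv : ∀ i j, a i (v j) = 0)
    (hu : ∀ i j, a i (u j) = if i = j then 1 else 0) :
    ∃ K : ℝ, 0 < K ∧ ∀ (h : (p + p) + (r + r) = (p + r) * 2)
      (α : CSpace (p + r) [⋀^Fin (p + p)]→ₗ[ℝ] ℂ) (c : ℝ),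
      (wedge α (elementaryForm a)).domDomCongr (finCongr h) = c • stdVolume (p + r) ↔
        α (doubleFrame v) = ((K * c : ℝ) : ℂ) := by
  have hD := stdVolume_realFrame_pos hvu
  set D := Complex.normSq (Matrix.of fun i j => Fin.append v u j i).det with hDdef
  refine ⟨2 ^ p * D, by positivity, fun h α c => ?_⟩
  have h1 : (wedge α (elementaryForm a)).domDomCongr (finCongr h) (realFrame (Fin.append v u)) =
      α (doubleFrame v) * 2 ^ r := by
    rw [AlternatingMap.domDomCongr_apply]
    rw [realFrame_append, wedge_apply_of_vanish, elementaryForm_doubleFrame]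
    · have : (Matrix.of fun i j => a i (u j)) = 1 := by
        ext i j; simp [hu, Matrix.one_apply]
      rw [this]
      simp
    · rintro w ⟨i, j, hij⟩
      refine elementaryForm_eq_zero a w (i := i) fun k => ?_
      rw [hij, doubleFrame_apply]
      split_ifs <;> simp [hv]
  have h2 : stdVolume (p + r) (realFrame (Fin.append v u)) = 2 ^ r * (2 ^ p * D : ℝ) := by
    rw [stdVolume_realFrame, ← hDdef]
    push_cast
    ring
  have h2r : (2 : ℂ) ^ r ≠ 0 := pow_ne_zero _ two_ne_zero
  constructor
  · intro H
    have := congrArg (fun η => η (realFrame (Fin.append v u))) H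
    simp only [AlternatingMap.smul_apply] at this
    rw [h1, h2, Complex.real_smul] at this
    apply mul_right_cancel₀ h2r
    rw [this]
    push_cast
    ring
  · intro H
    apply top_form_eq_smul hvu
    rw [h1, h2, H]
    push_cast
    ring

theorem exists_adapted_frame_of_forms {p r : ℕ} {a : Fin r → (CSpace (p + r) →ₗ[ℂ] ℂ)}
    (ha : LinearIndependent ℂ a) :
    ∃ (v : Fin p → CSpace (p + r)) (u : Fin r → CSpace (p + r)),
      LinearIndependent ℂ (Fin.append v u) ∧ (∀ i j, a i (v j) = 0) ∧
        ∀ i j, a i (u j) = if i = j then 1 else 0 := by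
  set f : CSpace (p + r) →ₗ[ℂ] (Fin r → ℂ) := LinearMap.pi a with hf
  -- Independence of the `a i` says exactly that the dual map of `f` is injective.
  have hsurj : Function.Surjective f := by
    rw [← LinearMap.dualMap_injective_iff, ← LinearMap.ker_eq_bot, LinearMap.ker_eq_bot']
    intro φ hφ
    have h0 : ∑ i, φ (Pi.single i 1) • a i = 0 := by
      refine LinearMap.ext fun x => ?_
      have := congrArg (fun g => g x) hφ
      simp only [LinearMap.dualMap_apply, LinearMap.zero_apply] at this
      rw [LinearMap.pi_apply_eq_sum_univ φ] at this
      have hs : ∀ i : Fin r, (fun j => if i = j then (1 : ℂ) else 0) = Pi.single i 1 := by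
        intro i; ext j; simp [Pi.single_apply, eq_comm]
      simpa [hf, mul_comm, hs] using this
    have := Fintype.linearIndependent_iff.1 ha _ h0
    refine LinearMap.pi_ext' fun i => LinearMap.ext_ring ?_
    simpa using this i
  have hker : Module.finrank ℂ (LinearMap.ker f) = p := by
    have := LinearMap.finrank_range_add_finrank_ker f
    rw [LinearMap.range_eq_top.2 hsurj, finrank_top] at this
    simp at this
    omega
  let b := Module.finBasisOfFinrankEq ℂ (LinearMap.ker f) hker
  choose u hu using fun j : Fin r => hsurj (Pi.single j 1)
  have hv : ∀ i j, a i (b j : CSpace (p + r)) = 0 := fun i j =>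
    congrFun (LinearMap.mem_ker.1 (b j).2) i
  have hu' : ∀ i j, a i (u j) = if i = j then 1 else 0 := by
    intro i j
    have := congrFun (hu j) i
    rw [Pi.single_apply] at this
    exact this
  refine ⟨fun j => b j, u, ?_, hv, hu'⟩
  rw [Fintype.linearIndependent_iff]
  intro g hg
  rw [Fin.sum_univ_add] at hg
  simp only [Fin.append_left, Fin.append_right] at hg
  have hgr : ∀ i, g (Fin.natAdd p i) = 0 := by
    intro i
    have := congrArg (a i) hg
    simpa [hv, hu'] using this
  simp only [hgr, zero_smul, Finset.sum_const_zero, add_zero] at hg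
  have hb := b.linearIndependent.map' (LinearMap.ker f).subtype (by simp)
  have hgl := Fintype.linearIndependent_iff.1 hb (fun i => g (Fin.castAdd r i)) (by simpa using hg)
  intro i
  refine Fin.addCases hgl hgr i

theorem exists_adapted_forms_of_frame {p r : ℕ} {v : Fin p → CSpace (p + r)}
    (hv : LinearIndependent ℂ v) :
    ∃ (a : Fin r → (CSpace (p + r) →ₗ[ℂ] ℂ)) (u : Fin r → CSpace (p + r)),
      LinearIndependent ℂ a ∧ LinearIndependent ℂ (Fin.append v u) ∧ (∀ i j, a i (v j) = 0) ∧
        ∀ i j, a i (u j) = if i = j then 1 else 0 := by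
  obtain ⟨W, hW⟩ := Submodule.exists_isCompl (Submodule.span ℂ (range v))
  have hr : Module.finrank ℂ W = r := by
    have := Submodule.finrank_add_eq_of_isCompl hW
    rw [finrank_span_eq_card hv] at this
    simp at this
    exact this
  let b := Module.finBasisOfFinrankEq ℂ W hr
  let u : Fin r → CSpace (p + r) := fun j => b j
  have hu : LinearIndependent ℂ u := b.linearIndependent.map' W.subtype (by simp)
  have hvu : LinearIndependent ℂ (Fin.append v u) := by
    have h : LinearIndependent ℂ (Sum.elim v u) := by
      refine hv.sum_type hu (hW.disjoint.mono_right ?_)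
      rw [Submodule.span_le]
      rintro _ ⟨j, rfl⟩
      exact (b j).2
    have h2 := h.comp finSumFinEquiv.symm finSumFinEquiv.symm.injective
    convert h2 using 1
    ext1 s
    obtain ⟨s, rfl⟩ := finSumFinEquiv.surjective s
    rcases s with s | s <;> simp [-Fin.natAdd_eq_addNat]
  let B := Module.Basis.mk hvu (hvu.span_eq_top_of_card_eq_finrank' (by simp)).ge
  have hBv : ∀ j, B (Fin.castAdd r j) = v j := fun j => by simp [B]
  have hBu : ∀ j, B (Fin.natAdd p j) = u j := fun j => by simp [B, -Fin.natAdd_eq_addNat]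
  have hav : ∀ i j, B.coord (Fin.natAdd p i) (v j) = 0 := by
    intro i j
    rw [← hBv, Module.Basis.coord_apply, Module.Basis.repr_self, Finsupp.single_apply, if_neg]
    simp only [Fin.ext_iff, Fin.val_castAdd, Fin.val_natAdd]
    omega
  have hau : ∀ i j, B.coord (Fin.natAdd p i) (u j) = if i = j then 1 else 0 := by
    intro i j
    rw [← hBu, Module.Basis.coord_apply, Module.Basis.repr_self, Finsupp.single_apply]
    simp [Fin.ext_iff, -Fin.natAdd_eq_addNat, eq_comm]
  refine ⟨fun i => B.coord (Fin.natAdd p i), u, ?_, hvu, hav, hau⟩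
  rw [Fintype.linearIndependent_iff]
  intro g hg i
  have := congrArg (fun f => f (u i)) hg
  simpa [hau, -Module.Basis.coord_apply] using this

/-- A form is strictly positive iff it restricts to a positive volume form on every complex
subspace of dimension `p`. -/
theorem isStrictlyPositiveForm_iff {N p : ℕ} {α : CSpace N [⋀^Fin (p + p)]→L[ℝ] ℂ} :
    IsStrictlyPositiveForm p α ↔ IsRealForm α ∧ IsOfType p p α ∧ p ≤ N ∧
      ∀ v : Fin p → CSpace N, LinearIndependent ℂ v → 0 < (α (doubleFrame v)).re := by
  have hreal : IsRealForm α → ∀ w, α w = ((α w).re : ℂ) := fun h w =>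
    (Complex.conj_eq_iff_re.1 (h w)).symm
  constructor
  · rintro ⟨hr, ht, r, rfl, H⟩
    refine ⟨hr, ht, by omega, fun v hv => ?_⟩
    -- Given `v`, take as `a` the coordinate forms of a complement to the span of `v`; in the other
    -- direction, given `a`, take as `v` a basis of their common kernel.
    obtain ⟨a, u, ha, hvu, hav, hau⟩ := exists_adapted_forms_of_frame hv
    obtain ⟨K, hK, hKa⟩ := wedge_elementaryForm_eq_smul_iff hvu hav hau
    obtain ⟨h, c, hc, hη⟩ := H a ha
    have := (hKa h _ c).1 hη
    change α (doubleFrame v) = _ at this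
    rw [this, Complex.ofReal_re]
    positivity
  · rintro ⟨hr, ht, hp, H⟩
    obtain ⟨r, rfl⟩ := Nat.exists_eq_add_of_le hp
    refine ⟨hr, ht, r, rfl, fun a ha => ?_⟩
    obtain ⟨v, u, hvu, hav, hau⟩ := exists_adapted_frame_of_forms ha
    obtain ⟨K, hK, hKa⟩ := wedge_elementaryForm_eq_smul_iff hvu hav hau
    have hv : LinearIndependent ℂ v := by
      have := hvu.comp (Fin.castAdd r) (Fin.castAdd_injective p r)
      convert this using 1
      ext1 i
      simp
    have hpos := H v hv
    have h : (p + p) + (r + r) = (p + r) * 2 := by omega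
    refine ⟨h, (α (doubleFrame v)).re / K, by positivity, (hKa h _ _).2 ?_⟩
    rw [mul_div_cancel₀ _ hK.ne']
    exact hreal hr _

/-- The real and imaginary parts of the coefficients of a complex relation give a real relation of
the frame. Hence an alternating form vanishes on the frame of a dependent family, which yields
semipositivity for degenerate pullbacks. -/
theorem linearIndependent_of_doubleFrame {E : Type*} [AddCommGroup E] [Module ℂ E] {p : ℕ}
    {v : Fin p → E} (h : LinearIndependent ℝ (doubleFrame v)) : LinearIndependent ℂ v := by
  have h' : LinearIndependent ℝ (Sum.elim v (fun j => Complex.I • v j)) := by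
    have := h.comp ((interleave p).trans (finCongr (mul_two p))) (Equiv.injective _)
    convert this using 1
    ext1 s
    simp [doubleFrame, realFrame]
  rw [Fintype.linearIndependent_iff] at h' ⊢
  intro g hg i
  have key := h' (Sum.elim (fun i => (g i).re) (fun i => (g i).im)) (by
    simp only [Fintype.sum_sum_type, Sum.elim_inl, Sum.elim_inr]
    rw [← Finset.sum_add_distrib, ← hg]
    refine Finset.sum_congr rfl fun j _ => ?_
    conv_rhs => rw [← Complex.re_add_im (g j), add_smul, mul_smul]
    rfl)
  exact Complex.ext (key (Sum.inl i)) (key (Sum.inr i))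

theorem IsStrictlyPositiveForm.nonneg {N p : ℕ} {α : CSpace N [⋀^Fin (p + p)]→L[ℝ] ℂ}
    (h : IsStrictlyPositiveForm p α) (v : Fin p → CSpace N) : 0 ≤ (α (doubleFrame v)).re := by
  by_cases hv : LinearIndependent ℂ v
  · exact ((isStrictlyPositiveForm_iff.1 h).2.2.2 v hv).le
  · have : α.toAlternatingMap (doubleFrame v) = 0 :=
      AlternatingMap.map_linearDependent _ _ fun h => hv (linearIndependent_of_doubleFrame h)
    exact (congrArg Complex.re this).ge

theorem comp_doubleFrame {E F : Type*} [AddCommGroup E] [Module ℂ E] [AddCommGroup F] [Module ℂ F]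
    (B : E →ₗ[ℂ] F) {p : ℕ} (v : Fin p → E) : B ∘ doubleFrame v = doubleFrame (B ∘ v) := by
  ext1 s
  rw [Function.comp_apply, doubleFrame_apply, doubleFrame_apply]
  split_ifs <;> simp

/-- The sum of a strictly positive form and of pullbacks of strictly positive forms along complex
linear maps is strictly positive. -/
theorem IsStrictlyPositiveForm.add_sum_compContinuousLinearMap {N p : ℕ} {ι : Type*}
    (s : Finset ι) {M : ι → ℕ} {α : CSpace N [⋀^Fin (p + p)]→L[ℝ] ℂ}
    (hα : IsStrictlyPositiveForm p α) (β : ∀ j, CSpace (M j) [⋀^Fin (p + p)]→L[ℝ] ℂ)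
    (hβ : ∀ j ∈ s, IsStrictlyPositiveForm p (β j)) (B : ∀ j, CSpace N →L[ℂ] CSpace (M j)) :
    IsStrictlyPositiveForm p
      (α + ∑ j ∈ s, (β j).compContinuousLinearMap ((B j).restrictScalars ℝ)) := by
  obtain ⟨hr, ht, hp, hpos⟩ := isStrictlyPositiveForm_iff.1 hα
  rw [isStrictlyPositiveForm_iff]
  refine ⟨fun v => ?_, ⟨rfl, fun c v => ?_⟩, hp, fun v hv => ?_⟩
  · simp only [ContinuousAlternatingMap.add_apply, ContinuousAlternatingMap.sum_apply, map_add, map_sum, hr v,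
      ContinuousAlternatingMap.compContinuousLinearMap_apply]
    congr 1
    exact Finset.sum_congr rfl fun j hj => (hβ j hj).1 _
  · simp only [ContinuousAlternatingMap.add_apply, ContinuousAlternatingMap.sum_apply, mul_add, Finset.mul_sum, ht.2 c v,
      ContinuousAlternatingMap.compContinuousLinearMap_apply]
    congr 1
    refine Finset.sum_congr rfl fun j hj => ?_
    rw [← (hβ j hj).2.1.2 c]
    congr 1
    ext1 i
    simp
  · simp only [ContinuousAlternatingMap.add_apply, ContinuousAlternatingMap.sum_apply, Complex.add_re, Complex.re_sum,
      ContinuousAlternatingMap.compContinuousLinearMap_apply]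
    refine add_pos_of_pos_of_nonneg (hpos v hv) (Finset.sum_nonneg fun j hj => ?_)
    have := (hβ j hj).nonneg (B j ∘ v)
    rwa [← ContinuousLinearMap.coe_coe, ← comp_doubleFrame] at this

/-! ### Isomorphisms between open sets, parametrizations and local embeddings. -/

open FunctionSheaf

section Geometry

variable {X Y Z : Type*} [TopologicalSpace X] [FunctionSheaf X] [TopologicalSpace Y]
  [FunctionSheaf Y] [TopologicalSpace Z] [FunctionSheaf Z]

theorem holAt_congr_iff {g h : X → ℂ} {x : X} (e : g =ᶠ[𝓝 x] h) : HolAt g x ↔ HolAt h x :=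
  ⟨holAt_congr e, holAt_congr e.symm⟩

namespace IsIsoOn

variable {f : X → Y} {U : Set X} {V : Set Y}

theorem continuousOn (h : IsIsoOn f U V) : ContinuousOn f U :=
  continuousOn_iff_continuous_domRestrict.2 h.isEmbedding.continuous

theorem isOpen_image (h : IsIsoOn f U V) {O : Set X} (hO : IsOpen O) (hOU : O ⊆ U) :
    IsOpen (f '' O) := by
  have he : IsOpenEmbedding (U.domRestrict f) :=
    ⟨h.isEmbedding, by rw [range_domRestrict, h.bijOn.image_eq]; exact h.isOpen_target⟩
  have := he.isOpenMap _ (hO.preimage continuous_subtype_val)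
  rwa [image_domRestrict, inter_eq_left.2 hOU] at this

theorem of_isOpen_image (hU : IsOpen U) (hb : BijOn f U V) (hc : ContinuousOn f U)
    (ho : ∀ O : Set X, IsOpen O → O ⊆ U → IsOpen (f '' O))
    (hh : ∀ x ∈ U, ∀ g : Y → ℂ, HolAt g (f x) ↔ HolAt (g ∘ f) x) : IsIsoOn f U V where
  isOpen_source := hU
  isOpen_target := by rw [← hb.image_eq]; exact ho U hU subset_rfl
  bijOn := hb
  isEmbedding := by
    refine (IsOpenEmbedding.of_continuous_injective_isOpenMap
      (continuousOn_iff_continuous_domRestrict.1 hc) (injOn_iff_injective.1 hb.injOn)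
      fun W hW => ?_).isEmbedding
    have : U.domRestrict f '' W = f '' (Subtype.val '' W) := by
      rw [← image_comp]; rfl
    rw [this]
    exact ho _ (hU.isOpenMap_subtype_val _ hW) (by rintro _ ⟨x, _, rfl⟩; exact x.2)
  holAt_iff := hh

theorem mono (h : IsIsoOn f U V) {O : Set X} (hO : IsOpen O) (hOU : O ⊆ U) :
    IsIsoOn f O (f '' O) :=
  of_isOpen_image hO (h.bijOn.injOn.mono hOU).bijOn_image (h.continuousOn.mono hOU)
    (fun _ hW hWO => h.isOpen_image hW (hWO.trans hOU)) fun x hx => h.holAt_iff x (hOU hx)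

theorem comp {g : Y → Z} {W : Set Z} (hg : IsIsoOn g V W) (hf : IsIsoOn f U V) :
    IsIsoOn (g ∘ f) U W :=
  of_isOpen_image hf.isOpen_source (hg.bijOn.comp hf.bijOn)
    (hg.continuousOn.comp hf.continuousOn hf.bijOn.mapsTo)
    (fun O hO hOU => by
      rw [image_comp]
      exact hg.isOpen_image (hf.isOpen_image hO hOU)
        ((image_mono hOU).trans hf.bijOn.image_eq.subset))
    fun x hx k => by
      rw [Function.comp_apply, hg.holAt_iff _ (hf.bijOn.mapsTo hx), hf.holAt_iff x hx]
      rfl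

theorem eventually_mem (h : IsIsoOn f U V) {x : X} (hx : x ∈ U) : ∀ᶠ z in 𝓝 x, z ∈ U :=
  h.isOpen_source.mem_nhds hx

theorem exists_inverse (h : IsIsoOn f U V) (hU : U.Nonempty) :
    ∃ g : Y → X, IsIsoOn g V U ∧ LeftInvOn g f U ∧ RightInvOn g f V := by
  -- A point of `X` is needed only to give `invFunOn` a value off `V`.
  obtain ⟨x₀, hx₀⟩ := hU
  have : Nonempty X := ⟨x₀⟩
  let g := Function.invFunOn f U
  have hl : LeftInvOn g f U := h.bijOn.injOn.leftInvOn_invFunOn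
  have hr : RightInvOn g f V := h.bijOn.surjOn.rightInvOn_invFunOn
  have hgm : MapsTo g V U := h.bijOn.surjOn.mapsTo_invFunOn
  refine ⟨g, of_isOpen_image h.isOpen_target ⟨hgm, hr.injOn, ?_⟩ ?_ ?_ ?_, hl, hr⟩
  · intro x hx
    exact ⟨f x, h.bijOn.mapsTo hx, hl hx⟩
  · rw [continuousOn_open_iff h.isOpen_target]
    intro O hO
    have : V ∩ g ⁻¹' O = f '' (U ∩ O) := by
      ext y
      constructor
      · rintro ⟨hy, hyO⟩
        exact ⟨g y, ⟨hgm hy, hyO⟩, hr hy⟩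
      · rintro ⟨x, ⟨hx, hxO⟩, rfl⟩
        refine ⟨h.bijOn.mapsTo hx, ?_⟩
        rw [mem_preimage, hl hx]
        exact hxO
    rw [this]
    exact h.isOpen_image (h.isOpen_source.inter hO) inter_subset_left
  · intro O hO hOV
    have : g '' O = U ∩ f ⁻¹' O := by
      ext x
      constructor
      · rintro ⟨y, hy, rfl⟩
        refine ⟨hgm (hOV hy), ?_⟩
        rw [mem_preimage, hr (hOV hy)]
        exact hy
      · rintro ⟨hx, hxO⟩
        exact ⟨f x, hxO, hl hx⟩
    rw [this]
    exact h.continuousOn.isOpen_inter_preimage h.isOpen_source hO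
  · intro y hy k
    have h1 := h.holAt_iff (g y) (hgm hy) (k ∘ g)
    rw [hr hy] at h1
    rw [h1]
    refine holAt_congr_iff ?_
    filter_upwards [h.eventually_mem (hgm hy)] with x hx
    rw [Function.comp_apply, Function.comp_apply, hl hx]

end IsIsoOn

namespace RegularParam

variable {m : ℕ}

theorem isOpen_source (φ : RegularParam X m) : IsOpen φ.source := φ.isIsoOn.isOpen_source

/-- The composition of a parametrization with an isomorphism between open subsets. -/
def mapIso (φ : RegularParam X m) {f : X → Y} {U : Set X} {V : Set Y} (h : IsIsoOn f U V) :
    RegularParam Y m where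
  source := φ.source ∩ φ.toFun ⁻¹' U
  toFun := f ∘ φ.toFun
  isIsoOn := by
    have hO : IsOpen (φ.source ∩ φ.toFun ⁻¹' U) :=
      φ.isIsoOn.continuousOn.isOpen_inter_preimage φ.isOpen_source h.isOpen_source
    have h1 := φ.isIsoOn.mono hO inter_subset_left
    have h2 := h.mono h1.isOpen_target (by rintro _ ⟨t, ht, rfl⟩; exact ht.2)
    rw [image_comp]
    exact h2.comp h1

end RegularParam

theorem hasDimension_iff_of_isLocalIsomorphism {f : X → Y} (hf : IsLocalIsomorphism f) {n : ℕ} :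
    HasDimension X n ↔ HasDimension Y n := by
  have : {m : ℕ | ∃ φ : RegularParam X m, φ.source.Nonempty} =
      {m : ℕ | ∃ φ : RegularParam Y m, φ.source.Nonempty} := by
    ext m
    constructor
    · rintro ⟨φ, t, ht⟩
      obtain ⟨U, V, hxU, hxV, h⟩ := hf.2 (φ.toFun t)
      exact ⟨φ.mapIso h, t, ht, hxU⟩
    · rintro ⟨φ, t, ht⟩
      obtain ⟨x, hx⟩ := hf.1 (φ.toFun t)
      obtain ⟨U, V, hxU, hxV, h⟩ := hf.2 x
      obtain ⟨g, hg, -, -⟩ := h.exists_inverse ⟨x, hxU⟩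
      exact ⟨φ.mapIso hg, t, ht, by rw [mem_preimage, ← hx]; exact hxV⟩
  rw [HasDimension, HasDimension, this]

namespace LocalEmbedding

variable {N : ℕ}

theorem continuousOn (i : LocalEmbedding X N) : ContinuousOn i.toFun i.source :=
  continuousOn_iff_continuous_domRestrict.2 i.isEmbedding.continuous

theorem mapsTo (i : LocalEmbedding X N) : MapsTo i.toFun i.source i.target := fun _ hx =>
  i.isAnalyticSubset_image.1 (mem_image_of_mem _ hx)

/-- The restriction of a local embedding to an open subset of the target. -/
def restrictTarget (i : LocalEmbedding X N) (W : Set (CSpace N)) (hW : IsOpen W) :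
    LocalEmbedding X N where
  source := i.source ∩ i.toFun ⁻¹' W
  target := i.target ∩ W
  toFun := i.toFun
  isOpen_source := i.continuousOn.isOpen_inter_preimage i.isOpen_source hW
  isOpen_target := i.isOpen_target.inter hW
  isEmbedding := i.isEmbedding.comp (IsEmbedding.inclusion inter_subset_left)
  isAnalyticSubset_image := by
    rw [image_inter_preimage]
    refine ⟨inter_subset_inter_left _ i.isAnalyticSubset_image.1, fun a ha => ?_⟩
    obtain ⟨W', hW', haW', hW'V, r, g, hg, h⟩ := i.isAnalyticSubset_image.2 a ha.1
    refine ⟨W' ∩ W, hW'.inter hW, ⟨haW', ha.2⟩, inter_subset_inter_left _ hW'V, r, g,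
      fun j => (hg j).mono inter_subset_left, ?_⟩
    have : i.toFun '' i.source ∩ W ∩ (W' ∩ W) = (i.toFun '' i.source ∩ W') ∩ W := by
      ext z; simp only [mem_inter_iff]; tauto
    rw [this, h]
    ext z; simp only [mem_inter_iff, mem_ofPred_eq]; tauto
  holAt_iff := fun x hx => i.holAt_iff x hx.1

/-- The topology of the source is induced from the ambient space, so intersecting the target with
one small open set shrinks source and target together and keeps the image analytic in the target. -/
theorem exists_restrict (i : LocalEmbedding X N) {x : X} (hx : x ∈ i.source) {O : Set X}
    (hO : O ∈ 𝓝 x) {W : Set (CSpace N)} (hW : W ∈ 𝓝 (i.toFun x)) :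
    ∃ j : LocalEmbedding X N, j.toFun = i.toFun ∧ x ∈ j.source ∧ j.source ⊆ i.source ∩ O ∧
      j.target ⊆ i.target ∩ W := by
  have h1 : (Subtype.val ⁻¹' O : Set i.source) ∈ 𝓝 (⟨x, hx⟩ : i.source) :=
    continuous_subtype_val.continuousAt.preimage_mem_nhds hO
  rw [i.isEmbedding.isInducing.nhds_eq_comap, mem_comap] at h1
  obtain ⟨W₁, hW₁, hWO⟩ := h1
  obtain ⟨W₂, hW₂, hW₂o, hxW₂⟩ := mem_nhds_iff.1 (inter_mem hW₁ hW)
  refine ⟨i.restrictTarget W₂ hW₂o, rfl, ⟨hx, hxW₂⟩, ?_, ?_⟩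
  · rintro z ⟨hz, hzW⟩
    refine ⟨hz, ?_⟩
    have : (⟨z, hz⟩ : i.source) ∈ i.source.domRestrict i.toFun ⁻¹' W₁ := (hW₂ hzW).1
    exact hWO this
  · exact inter_subset_inter_right _ (hW₂.trans inter_subset_right)

/-- The composition of a local embedding with an isomorphism onto an open set which contains its
source. -/
def compIso (i : LocalEmbedding Y N) {f : X → Y} {U : Set X} {V : Set Y} (h : IsIsoOn f U V)
    (hi : i.source ⊆ V) : LocalEmbedding X N where
  source := U ∩ f ⁻¹' i.source
  target := i.target
  toFun := i.toFun ∘ f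
  isOpen_source := h.continuousOn.isOpen_inter_preimage h.isOpen_source i.isOpen_source
  isOpen_target := i.isOpen_target
  isEmbedding := by
    have h1 : IsEmbedding ((U ∩ f ⁻¹' i.source).domRestrict f) :=
      h.isEmbedding.comp (IsEmbedding.inclusion inter_subset_left)
    exact i.isEmbedding.comp (h1.codRestrict i.source fun x => x.2.2)
  isAnalyticSubset_image := by
    have : f '' (U ∩ f ⁻¹' i.source) = i.source := by
      rw [image_inter_preimage, h.bijOn.image_eq, inter_eq_right.2 hi]
    rw [image_comp, this]
    exact i.isAnalyticSubset_image
  holAt_iff := by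
    rintro x ⟨hx, hxi⟩ k
    -- A function `k` on `X` corresponds to `k ∘ g` on `Y`, to which the condition for `i` applies.
    obtain ⟨g, hg, hl, hr⟩ := h.exists_inverse ⟨x, hx⟩
    have h1 := hg.holAt_iff (f x) (h.bijOn.mapsTo hx) k
    rw [hl hx] at h1
    rw [h1, i.holAt_iff _ hxi]
    have hfx : ContinuousAt f x := h.continuousOn.continuousAt (h.eventually_mem hx)
    have hgx : ContinuousAt g (f x) :=
      hg.continuousOn.continuousAt (hg.eventually_mem (h.bijOn.mapsTo hx))
    refine exists_congr fun G => and_congr_right fun _ => ⟨fun e => ?_, fun e => ?_⟩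
    · filter_upwards [hfx.eventually e, h.eventually_mem hx] with z hz hzU
      rwa [Function.comp_apply, hl hzU] at hz
    · rw [← hl hx] at e
      filter_upwards [hgx.eventually e, hg.eventually_mem (h.bijOn.mapsTo hx)] with z hz hzV
      rwa [Function.comp_apply, Function.comp_apply, hr hzV] at hz

end LocalEmbedding

end Geometry

/-! ### Pullback of ambient forms and its smoothness. -/

section Pullback

variable {m N M k : ℕ}

theorem pullback_congr {h h' : CSpace m → CSpace N} {t : CSpace m} (e : h =ᶠ[𝓝 t] h')
    (θ : CSpace N → CSpace N [⋀^Fin k]→L[ℝ] ℂ) : pullback h θ t = pullback h' θ t := by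
  rw [pullback, pullback, e.fderiv_eq, e.eq_of_nhds]

theorem pullback_comp {h : CSpace m → CSpace N} {g : CSpace N → CSpace M} {t : CSpace m}
    (hg : DifferentiableAt ℝ g (h t)) (hh : DifferentiableAt ℝ h t)
    (θ : CSpace M → CSpace M [⋀^Fin k]→L[ℝ] ℂ) :
    pullback (g ∘ h) θ t = pullback h (pullback g θ) t := by
  rw [pullback, fderiv_comp t hg hh]
  rfl

theorem pullback_add (h : CSpace m → CSpace N) (θ θ' : CSpace N → CSpace N [⋀^Fin k]→L[ℝ] ℂ)
    (t : CSpace m) : pullback h (fun z => θ z + θ' z) t = pullback h θ t + pullback h θ' t := rfl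

theorem pullback_sum {ι : Type*} (s : Finset ι) (h : CSpace m → CSpace N)
    (θ : ι → CSpace N → CSpace N [⋀^Fin k]→L[ℝ] ℂ) (t : CSpace m) :
    pullback h (fun z => ∑ j ∈ s, θ j z) t = ∑ j ∈ s, pullback h (θ j) t := by
  ext v
  simp [pullback, ContinuousAlternatingMap.sum_apply]

/-- In finite dimension the inclusion of alternating into multilinear maps has a continuous linear
retraction. Smoothness of composition with linear maps then passes from multilinear to alternating
forms. -/
theorem exists_leftInverse_toContinuousMultilinearMap (m k : ℕ) :
    ∃ g : ContinuousMultilinearMap ℝ (fun _ : Fin k => CSpace m) ℂ →L[ℝ]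
      CSpace m [⋀^Fin k]→L[ℝ] ℂ, ∀ α, g α.toContinuousMultilinearMap = α := by
  have : Module.Finite ℝ (MultilinearMap ℝ (fun _ : Fin k => CSpace m) ℂ) :=
    Module.Finite.multilinearMap
  have hfin : FiniteDimensional ℝ (ContinuousMultilinearMap ℝ (fun _ : Fin k => CSpace m) ℂ) :=
    Module.Finite.of_injective
      (ContinuousMultilinearMap.toMultilinearMapLinear (R' := ℝ) (A := ℝ)
        (M₁ := fun _ : Fin k => CSpace m) (M₂ := ℂ))
      ContinuousMultilinearMap.toMultilinearMap_injective
  obtain ⟨g, hg⟩ := LinearMap.exists_leftInverse_of_injective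
    (ContinuousAlternatingMap.toContinuousMultilinearMapCLM (E := CSpace m) (F := ℂ) (ι := Fin k)
      (𝕜 := ℝ) ℝ).toLinearMap
    (LinearMap.ker_eq_bot.2 ContinuousAlternatingMap.toContinuousMultilinearMap_injective)
  exact ⟨LinearMap.toContinuousLinearMap g, fun α => LinearMap.congr_fun hg α⟩

theorem contDiffAt_compContinuousLinearMap {f : CSpace m → CSpace N [⋀^Fin k]→L[ℝ] ℂ}
    {g : CSpace m → CSpace m →L[ℝ] CSpace N} {t : CSpace m} {n : WithTop ℕ∞}
    (hf : ContDiffAt ℝ n f t) (hg : ContDiffAt ℝ n g t) :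
    ContDiffAt ℝ n (fun x => (f x).compContinuousLinearMap (g x)) t := by
  obtain ⟨L, hL⟩ := exists_leftInverse_toContinuousMultilinearMap m k
  have h1 : ContDiffAt ℝ n (fun x => ((fun _ : Fin k => g x), (f x).toContinuousMultilinearMap)) t :=
    (contDiffAt_pi.2 fun _ => hg).prodMk
      ((ContinuousAlternatingMap.toContinuousMultilinearMapCLM (E := CSpace N) (F := ℂ)
        (ι := Fin k) (𝕜 := ℝ) ℝ).contDiff.contDiffAt.comp t hf)
  have h2 := (ContinuousMultilinearMap.analyticAt_uncurry_compContinuousLinearMap (𝕜 := ℝ)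
    (Fm := fun _ : Fin k => CSpace m) (Em := fun _ : Fin k => CSpace N) (G := ℂ)
    (q := ((fun _ : Fin k => g t), (f t).toContinuousMultilinearMap))).contDiffAt (n := n)
  have h3 := L.contDiff.contDiffAt.comp t (h2.comp t h1)
  refine h3.congr_of_eventuallyEq (Eventually.of_forall fun x => ?_)
  exact (hL _).symm

theorem contDiffAt_pullback {h : CSpace m → CSpace N} {t : CSpace m}
    {θ : CSpace N → CSpace N [⋀^Fin k]→L[ℝ] ℂ} (hh : AnalyticAt ℂ h t)
    (hθ : ContDiffAt ℝ ∞ θ (h t)) : ContDiffAt ℝ ∞ (pullback h θ) t := by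
  have hr : ContDiffAt ℝ ω h t := (hh.restrictScalars (𝕜 := ℝ)).contDiffAt
  exact contDiffAt_compContinuousLinearMap (hθ.comp t (hr.of_le le_top))
    (hr.fderiv_right (m := ∞) le_top)

theorem fderiv_real_eq {h : CSpace m → CSpace N} {t : CSpace m} (hh : AnalyticAt ℂ h t) :
    fderiv ℝ h t = (fderiv ℂ h t).restrictScalars ℝ :=
  (hh.differentiableAt.hasFDerivAt.restrictScalars ℝ).fderiv

end Pullback

/-! ### Smooth forms, their germs, and pullback along local isomorphisms. -/

section Forms

variable {X Y : Type*} [TopologicalSpace X] [FunctionSheaf X] [TopologicalSpace Y]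
  [FunctionSheaf Y] {m N k : ℕ}

theorem LocalEmbedding.holAt_apply (i : LocalEmbedding X N) {x : X} (hx : x ∈ i.source)
    (j : Fin N) : HolAt (fun z => i.toFun z j) x :=
  (i.holAt_iff x hx _).2
    ⟨fun z => z j, (ContinuousLinearMap.proj (R := ℂ) (φ := fun _ : Fin N => ℂ) j).analyticAt _,
      Eventually.of_forall fun _ => rfl⟩

theorem analyticAt_embedding_comp_param (i : LocalEmbedding X N) (φ : RegularParam X m)
    {t : CSpace m} (ht : t ∈ φ.source) (hi : φ.toFun t ∈ i.source) :
    AnalyticAt ℂ (i.toFun ∘ φ.toFun) t :=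
  analyticAt_pi_iff.2 fun j => (φ.isIsoOn.holAt_iff t ht _).1 (i.holAt_apply hi j)

theorem RegularParam.continuousAt (φ : RegularParam X m) {t : CSpace m} (ht : t ∈ φ.source) :
    ContinuousAt φ.toFun t :=
  φ.isIsoOn.continuousOn.continuousAt (φ.isOpen_source.mem_nhds ht)

namespace SmoothForm

variable (Ω : SmoothForm X k)

/-- Near its point the form is a pullback, which sees only the value and derivative of the
parametrization. This makes `germVal` independent of choices, and `germVal` is needed because `f ∘
φ` may fail to be injective on all of `φ.source`. -/
theorem val_eq_of_eventuallyEq {φ ψ : RegularParam X m} {t : CSpace m} (hφ : t ∈ φ.source)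
    (hψ : t ∈ ψ.source) (e : φ.toFun =ᶠ[𝓝 t] ψ.toFun) : Ω.val m φ t = Ω.val m ψ t := by
  obtain ⟨N, i, hi, θ, -, h⟩ := Ω.exists_extension (φ.toFun t)
  rw [h m φ t hφ hi, h m ψ t hψ (e.eq_of_nhds ▸ hi)]
  exact pullback_congr (e.fun_comp _) θ

theorem contDiffAt_val (φ : RegularParam X m) {t : CSpace m} (ht : t ∈ φ.source) :
    ContDiffAt ℝ ∞ (Ω.val m φ) t := by
  obtain ⟨N, i, hi, θ, hθ, h⟩ := Ω.exists_extension (φ.toFun t)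
  have h1 : ContDiffAt ℝ ∞ (pullback (i.toFun ∘ φ.toFun) θ) t :=
    contDiffAt_pullback (analyticAt_embedding_comp_param i φ ht hi)
      (hθ.contDiffAt (i.isOpen_target.mem_nhds (i.mapsTo hi)))
  refine h1.congr_of_eventuallyEq ?_
  filter_upwards [φ.isOpen_source.mem_nhds ht,
    (φ.continuousAt ht).preimage_mem_nhds (i.isOpen_source.mem_nhds hi)] with s hs hsi
  exact h m φ s hs hsi

open Classical in
/-- The value of a form at `t` in the parametrization whose germ at `t` is that of `c`. -/
def germVal (m : ℕ) (c : CSpace m → X) (t : CSpace m) : CSpace m [⋀^Fin k]→L[ℝ] ℂ :=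
  if h : ∃ ψ : RegularParam X m, t ∈ ψ.source ∧ ψ.toFun =ᶠ[𝓝 t] c then Ω.val m h.choose t else 0

theorem germVal_eq {c : CSpace m → X} {t : CSpace m} {ψ : RegularParam X m} (ht : t ∈ ψ.source)
    (e : ψ.toFun =ᶠ[𝓝 t] c) : Ω.germVal m c t = Ω.val m ψ t := by
  have h : ∃ ψ : RegularParam X m, t ∈ ψ.source ∧ ψ.toFun =ᶠ[𝓝 t] c := ⟨ψ, ht, e⟩
  rw [germVal, dif_pos h]
  exact Ω.val_eq_of_eventuallyEq h.choose_spec.1 ht (h.choose_spec.2.trans e.symm)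

theorem germVal_congr {c c' : CSpace m → X} {t : CSpace m} (e : c =ᶠ[𝓝 t] c') :
    Ω.germVal m c t = Ω.germVal m c' t := by
  have : ∀ ψ : RegularParam X m, (t ∈ ψ.source ∧ ψ.toFun =ᶠ[𝓝 t] c) ↔
      (t ∈ ψ.source ∧ ψ.toFun =ᶠ[𝓝 t] c') := fun ψ =>
    and_congr_right fun _ => ⟨fun h => h.trans e, fun h => h.trans e.symm⟩
  by_cases h : ∃ ψ : RegularParam X m, t ∈ ψ.source ∧ ψ.toFun =ᶠ[𝓝 t] c
  · obtain ⟨ψ, ht, hψ⟩ := h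
    rw [Ω.germVal_eq ht hψ, Ω.germVal_eq ht (hψ.trans e)]
  · rw [germVal, germVal, dif_neg h, dif_neg]
    simpa only [this] using h

theorem germVal_comp_eq {Ω : SmoothForm Y k} {f : X → Y} {U : Set X} {V : Set Y}
    (h : IsIsoOn f U V) (φ : RegularParam X m) {t : CSpace m} (ht : t ∈ φ.source)
    (hU : φ.toFun t ∈ U) : Ω.germVal m (f ∘ φ.toFun) t = Ω.val m (φ.mapIso h) t :=
  Ω.germVal_eq (ψ := φ.mapIso h) ⟨ht, hU⟩ EventuallyEq.rfl

end SmoothForm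

theorem extDeriv_sum_eq_zero {ι : Type*} (s : Finset ι)
    (η : ι → CSpace m → CSpace m [⋀^Fin k]→L[ℝ] ℂ) {t : CSpace m}
    (hd : ∀ j ∈ s, DifferentiableAt ℝ (η j) t) (h : ∀ j ∈ s, extDeriv (η j) t = 0) :
    extDeriv (fun z => ∑ j ∈ s, η j z) t = 0 := by
  classical
  induction s using Finset.induction_on with
  | empty =>
    ext v
    simp [extDeriv, ContinuousAlternatingMap.alternatizeUncurryFin_apply]
  | insert a s ha ih =>
    simp_rw [Finset.sum_insert ha]
    rw [extDeriv_fun_add (hd a (Finset.mem_insert_self a s))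
      (DifferentiableAt.fun_sum fun j hj => hd j (Finset.mem_insert_of_mem hj)),
      h a (Finset.mem_insert_self a s),
      ih (fun j hj => hd j (Finset.mem_insert_of_mem hj))
        (fun j hj => h j (Finset.mem_insert_of_mem hj)), add_zero]

/-! ### Pullback under a local isomorphism -/

/-- The embedding `i`, shrunk to lie in `V` and composed with `f`, has its target inside that of
`i`, so the same ambient form `θ` serves. -/
theorem exists_pullback_restriction {f : X → Y} {U : Set X} {V : Set Y} (h : IsIsoOn f U V)
    {x : X} (hx : x ∈ U) (Ω : SmoothForm Y k) {i : LocalEmbedding Y N} (hi : f x ∈ i.source)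
    {θ : CSpace N → CSpace N [⋀^Fin k]→L[ℝ] ℂ} (hθ : IsRestriction Ω.val i θ) :
    ∃ j : LocalEmbedding X N, x ∈ j.source ∧ j.target ⊆ i.target ∧
      IsRestriction (fun m φ => Ω.germVal m (f ∘ φ.toFun)) j θ := by
  obtain ⟨i₁, hi₁, hx₁, hs₁, ht₁⟩ := i.exists_restrict hi
    (h.isOpen_target.mem_nhds (h.bijOn.mapsTo hx)) univ_mem
  refine ⟨i₁.compIso h (hs₁.trans inter_subset_right), ⟨hx, hx₁⟩, ht₁.trans inter_subset_left,
    fun m φ t ht hφ => ?_⟩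
  beta_reduce
  rw [SmoothForm.germVal_comp_eq h φ ht hφ.1, hθ m (φ.mapIso h) t ⟨ht, hφ.1⟩ (hs₁ hφ.2).1, ← hi₁]
  rfl

/-- The pullback of a smooth form under a local isomorphism. -/
def SmoothForm.comap (Ω : SmoothForm Y k) {f : X → Y} (hf : IsLocalIsomorphism f) :
    SmoothForm X k where
  val m φ := Ω.germVal m (f ∘ φ.toFun)
  exists_extension x := by
    obtain ⟨U, V, hxU, -, h⟩ := hf.2 x
    obtain ⟨N, i, hi, θ, hθ, hr⟩ := Ω.exists_extension (f x)
    obtain ⟨j, hj, hji, hr'⟩ := exists_pullback_restriction h hxU Ω hi hr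
    exact ⟨N, j, hj, θ, hθ.mono hji, hr'⟩

/-- The equality holds near `t`, not only at `t`, so that exterior derivatives can be compared too.
-/
theorem SmoothForm.exists_comap_val_eq (Ω : SmoothForm Y k) {f : X → Y}
    (hf : IsLocalIsomorphism f) (φ : RegularParam X m) {t : CSpace m} (ht : t ∈ φ.source) :
    ∃ ψ : RegularParam Y m, t ∈ ψ.source ∧ (Ω.comap hf).val m φ =ᶠ[𝓝 t] Ω.val m ψ := by
  obtain ⟨U, V, hxU, -, h⟩ := hf.2 (φ.toFun t)
  refine ⟨φ.mapIso h, ⟨ht, hxU⟩, ?_⟩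
  filter_upwards [(φ.mapIso h).isOpen_source.mem_nhds ⟨ht, hxU⟩] with s hs
  exact SmoothForm.germVal_comp_eq h φ hs.1 hs.2

end Forms

theorem IsBalanced.of_isLocalIsomorphism {X Y : Type*} [TopologicalSpace X]
    [ReducedComplexSpace X] [TopologicalSpace Y] [ReducedComplexSpace Y] {f : X → Y}
    (hf : IsLocalIsomorphism f) (hY : IsBalanced Y) : IsBalanced X := by
  obtain ⟨n, hn, Ω, hc, hr, ht, hp⟩ := hY
  refine ⟨n, (hasDimension_iff_of_isLocalIsomorphism hf).2 hn, Ω.comap hf, ?_, ?_, ?_, ?_⟩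
  · intro m φ t hts
    obtain ⟨ψ, hψ, e⟩ := Ω.exists_comap_val_eq hf φ hts
    rw [e.extDeriv_eq, hc m ψ t hψ]
  · intro m φ t hts
    obtain ⟨ψ, hψ, e⟩ := Ω.exists_comap_val_eq hf φ hts
    rw [e.eq_of_nhds]
    exact hr m ψ t hψ
  · intro m φ t hts
    obtain ⟨ψ, hψ, e⟩ := Ω.exists_comap_val_eq hf φ hts
    rw [e.eq_of_nhds]
    exact ht m ψ t hψ
  · intro x
    obtain ⟨U, V, hxU, -, h⟩ := hf.2 x
    obtain ⟨N, i, hi, θ, hθ, hpos, hr⟩ := hp (f x)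
    obtain ⟨j, hj, hji, hr'⟩ := exists_pullback_restriction h hxU Ω hi hr
    exact ⟨N, j, hj, θ, hθ.mono hji, fun z hz => hpos z (hji hz), hr'⟩

/-! ### Fibres, local sections and the trace. -/

section Push

variable {X Y : Type*} [TopologicalSpace X] [FunctionSheaf X] [TopologicalSpace Y]
  [FunctionSheaf Y] {m k : ℕ}

/-- A choice, for every point `x` of `X`, of a local inverse `s x` of `f` with `s x (f x) = x`. -/
structure LocalSections (f : X → Y) (U : X → Set X) (V : X → Set Y) (s : X → Y → X) : Prop where
  mem : ∀ x, x ∈ U x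
  isIso : ∀ x, IsIsoOn f (U x) (V x)
  isIso_section : ∀ x, IsIsoOn (s x) (V x) (U x)
  leftInv : ∀ x, LeftInvOn (s x) f (U x)
  rightInv : ∀ x, RightInvOn (s x) f (V x)

theorem IsLocalIsomorphism.exists_localSections {f : X → Y} (hf : IsLocalIsomorphism f) :
    ∃ U V s, LocalSections f U V s := by
  choose U V hU _ h using hf.2
  choose s hs hl hr using fun x => (h x).exists_inverse ⟨x, hU x⟩
  exact ⟨U, V, s, hU, h, hs, hl, hr⟩

namespace LocalSections

variable {f : X → Y} {U : X → Set X} {V : X → Set Y} {s : X → Y → X}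

theorem mem_target (S : LocalSections f U V s) (x : X) : f x ∈ V x :=
  (S.isIso x).bijOn.mapsTo (S.mem x)

theorem section_apply (S : LocalSections f U V s) (x : X) : s x (f x) = x := S.leftInv x (S.mem x)

/-- Both are continuous local inverses of `f` with the same value at `y`. This allows the sections
at nearby fibre points to be replaced by those of one fixed fibre. -/
theorem eventuallyEq (S : LocalSections f U V s) {x : X} {y : Y} (hy : y ∈ V x) :
    s (s x y) =ᶠ[𝓝 y] s x := by
  set x' := s x y with hx'
  have hfx' : f x' = y := S.rightInv x hy
  have hc : ContinuousAt (s x) y :=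
    (S.isIso_section x).continuousOn.continuousAt ((S.isIso_section x).eventually_mem hy)
  have hy' : y ∈ V x' := hfx' ▸ S.mem_target x'
  filter_upwards [(S.isIso_section x).eventually_mem hy, (S.isIso_section x').eventually_mem hy',
    hc.eventually ((S.isIso x').eventually_mem (S.mem x'))] with z hz hz' hzU
  have := S.leftInv x' hzU
  rwa [S.rightInv x hz] at this

/-- The fibres of a local isomorphism of a compact space are finite, and near a given fibre they
are parametrized by the local inverses. -/
theorem exists_fiber_nhds [CompactSpace X] [T2Space X] [T2Space Y] (S : LocalSections f U V s)
    (y : Y) : ∃ F : Finset X, (F : Set X) = f ⁻¹' {y} ∧ ∃ O : Set Y, IsOpen O ∧ y ∈ O ∧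
      (∀ x ∈ F, O ⊆ V x) ∧ ∀ z ∈ O, InjOn (fun x => s x z) F ∧
        (fun x => s x z) '' (F : Set X) = f ⁻¹' {z} := by
  have hcont : Continuous f := continuous_iff_continuousAt.2 fun x =>
    (S.isIso x).continuousOn.continuousAt ((S.isIso x).eventually_mem (S.mem x))
  have hcpt : IsCompact (f ⁻¹' {y}) := (isClosed_singleton.preimage hcont).isCompact
  -- Since `f` is injective on each `U x`, every set of a finite subcover contains just one point of
  -- the fibre.
  have hfin : (f ⁻¹' {y}).Finite := by
    obtain ⟨t, ht, hst⟩ := hcpt.elim_nhds_subcover U fun x _ =>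
      (S.isIso x).isOpen_source.mem_nhds (S.mem x)
    refine t.finite_toSet.subset fun w hw => ?_
    obtain ⟨x, hx, hwx⟩ := mem_iUnion₂.1 (hst hw)
    have : w = x := (S.isIso x).bijOn.injOn hwx (S.mem x) (Eq.trans hw (ht x hx).symm)
    exact this ▸ hx
  obtain ⟨O₁, hO₁, hdisj⟩ := hfin.t2_separation
  let F := hfin.toFinset
  have hF : ∀ x, x ∈ F ↔ f x = y := fun x => by simp [F]
  -- The compact set `C` avoids the fibre, so its image is closed and misses `y`. Over the
  -- complement of that image, all fibre points lie in the chosen neighbourhoods and are hence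
  -- values of the sections.
  let C : Set X := (⋃ x ∈ F, O₁ x ∩ U x)ᶜ
  have hCc : IsClosed C := (isOpen_biUnion fun x _ =>
    (hO₁ x).2.inter (S.isIso x).isOpen_source).isClosed_compl
  have hyC : (f '' C)ᶜ ∈ 𝓝 y := by
    refine (hCc.isCompact.image hcont).isClosed.isOpen_compl.mem_nhds ?_
    rintro ⟨x, hx, hxy⟩
    exact hx (mem_biUnion ((hF x).2 hxy) ⟨(hO₁ x).1, S.mem x⟩)
  have hyV : ∀ x ∈ F, ∀ᶠ z in 𝓝 y, z ∈ V x ∧ s x z ∈ O₁ x := by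
    intro x hx
    have hxy := (hF x).1 hx
    have hyV : y ∈ V x := hxy ▸ S.mem_target x
    have hc : ContinuousAt (s x) y :=
      (S.isIso_section x).continuousOn.continuousAt ((S.isIso_section x).eventually_mem hyV)
    have hsx : s x y = x := by rw [← hxy]; exact S.section_apply x
    exact ((S.isIso_section x).eventually_mem hyV).and
      (hc.eventually ((hO₁ x).2.mem_nhds (by rw [hsx]; exact (hO₁ x).1)))
  obtain ⟨O, hO, hOo, hyO⟩ := mem_nhds_iff.1
    (inter_mem hyC ((Finset.eventually_all F).2 hyV))
  refine ⟨F, hfin.coe_toFinset, O, hOo, hyO, fun x hx z hz => ((hO hz).2 x hx).1,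
    fun z hz => ⟨fun x hx x' hx' e => ?_, ?_⟩⟩
  -- Sections at different points take values in disjoint sets `O₁ x`.
  · by_contra hne
    have h1 := ((hO hz).2 x hx).2
    have h2 := ((hO hz).2 x' hx').2
    simp only at e
    rw [← e] at h2
    exact (hdisj ((hF x).1 hx) ((hF x').1 hx') hne).le_bot ⟨h1, h2⟩
  · ext w
    constructor
    · rintro ⟨x, hx, rfl⟩
      exact S.rightInv x ((hO hz).2 x hx).1
    · intro hw
      have hwC : w ∉ C := fun hwC => (hO hz).1 ⟨w, hwC, hw⟩
      simp only [C, mem_compl_iff, not_not, mem_iUnion] at hwC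
      obtain ⟨x, hx, hwO, hwU⟩ := hwC
      refine ⟨x, hx, ?_⟩
      have := S.leftInv x hwU
      rwa [show f w = z from hw] at this

end LocalSections

end Push

section Push

variable {X Y : Type*} [TopologicalSpace X] [FunctionSheaf X] [TopologicalSpace Y]
  [FunctionSheaf Y] {m k : ℕ} {f : X → Y} {U : X → Set X} {V : X → Set Y} {s : X → Y → X}

/-- The trace of a form under a local isomorphism: the sum over the fibres of the pullbacks under
the local inverses. -/
def traceVal (f : X → Y) (s : X → Y → X) (Ω : SmoothForm X k) (m : ℕ) (φ : RegularParam Y m)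
    (t : CSpace m) : CSpace m [⋀^Fin k]→L[ℝ] ℂ :=
  ∑ᶠ x ∈ f ⁻¹' {φ.toFun t}, Ω.germVal m (s x ∘ φ.toFun) t

/-- The fibre over `φ t` is reindexed by the fixed set `F` through `x ↦ s x (φ t)`; the section
attached to `s x (φ t)` has the germ of `s x`. -/
theorem traceVal_eq_sum (S : LocalSections f U V s) (Ω : SmoothForm X k) {F : Finset X}
    {O : Set Y} (hV : ∀ x ∈ F, O ⊆ V x)
    (hO : ∀ z ∈ O, InjOn (fun x => s x z) F ∧ (fun x => s x z) '' (F : Set X) = f ⁻¹' {z})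
    (φ : RegularParam Y m) {t : CSpace m} (ht : t ∈ φ.source) (hφ : φ.toFun t ∈ O) :
    traceVal f s Ω m φ t = ∑ x ∈ F, Ω.val m (φ.mapIso (S.isIso_section x)) t := by
  rw [traceVal, ← (hO _ hφ).2, finsum_mem_image (hO _ hφ).1, finsum_mem_coe_finset]
  refine Finset.sum_congr rfl fun x hx => ?_
  rw [← SmoothForm.germVal_comp_eq (S.isIso_section x) φ ht (hV x hx hφ)]
  exact Ω.germVal_congr ((φ.continuousAt ht).eventually (S.eventuallyEq (hV x hx hφ)))

/-- If a family of forms on `Y` is the sum of the pullbacks of a form `Ω` on `X` under finitely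
many local sections `s x`, then extensions of `Ω` near the points `x` yield an extension near `y`
in the local embedding that is used at any given one of these points. -/
theorem exists_trace_restriction (S : LocalSections f U V s) (Ω : SmoothForm X k) {F : Finset X}
    {y : Y} (hF : ∀ x ∈ F, f x = y) {O : Set Y} (hOo : IsOpen O) (hyO : y ∈ O)
    (hV : ∀ x ∈ F, O ⊆ V x)
    {η : ∀ m : ℕ, RegularParam Y m → CSpace m → CSpace m [⋀^Fin k]→L[ℝ] ℂ}
    (hη : ∀ (m : ℕ) (φ : RegularParam Y m), ∀ t ∈ φ.source, φ.toFun t ∈ O →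
      η m φ t = ∑ x ∈ F, Ω.val m (φ.mapIso (S.isIso_section x)) t)
    {N : X → ℕ} {i : ∀ x, LocalEmbedding X (N x)} (hi : ∀ x, x ∈ (i x).source)
    {θ : ∀ x, CSpace (N x) → CSpace (N x) [⋀^Fin k]→L[ℝ] ℂ}
    (hθ : ∀ x, ContDiffOn ℝ ∞ (θ x) (i x).target) (hr : ∀ x, IsRestriction Ω.val (i x) (θ x))
    {a : X} (ha : a ∈ F) :
    ∃ (G : Finset X) (j : LocalEmbedding Y (N a)), y ∈ j.source ∧
      ∃ θ' : CSpace (N a) → CSpace (N a) [⋀^Fin k]→L[ℝ] ℂ, ContDiffOn ℝ ∞ θ' j.target ∧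
        IsRestriction η j θ' ∧ ∀ z ∈ j.target, z ∈ (i a).target ∧
          ∃ (B : ∀ x, CSpace (N a) →L[ℂ] CSpace (N x)) (w : ∀ x, CSpace (N x)),
            (∀ x ∈ G, w x ∈ (i x).target) ∧ θ' z = θ a z +
              ∑ x ∈ G, (θ x (w x)).compContinuousLinearMap ((B x).restrictScalars ℝ) := by
  classical
  have hyV : ∀ x ∈ F, y ∈ V x := fun x hx => hV x hx hyO
  have hsx : ∀ x ∈ F, s x y = x := fun x hx => by rw [← hF x hx]; exact S.section_apply x
  obtain ⟨i₁, hi₁, ha₁, hs₁, ht₁⟩ := (i a).exists_restrict (hi a)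
    ((S.isIso a).isOpen_source.mem_nhds (S.mem a)) univ_mem
  let e : LocalEmbedding Y (N a) :=
    i₁.compIso (S.isIso_section a) (hs₁.trans inter_subset_right)
  have he : e.toFun = (i a).toFun ∘ s a := by
    change i₁.toFun ∘ s a = _
    rw [hi₁]
  have hye : y ∈ e.source := ⟨hyV a ha, by rw [mem_preimage, hsx a ha]; exact ha₁⟩
  have hh : ∀ x, ∃ h : CSpace (N a) → CSpace (N x), x ∈ F →
      AnalyticAt ℂ h (e.toFun y) ∧ (i x).toFun ∘ s x =ᶠ[𝓝 y] h ∘ e.toFun := by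
    intro x
    by_cases hx : x ∈ F
    · have h1 : ∀ l : Fin (N x), HolAt (fun z => (i x).toFun (s x z) l) y := fun l =>
        ((S.isIso_section x).holAt_iff y (hyV x hx) fun z => (i x).toFun z l).1
          ((i x).holAt_apply (by rw [hsx x hx]; exact hi x) l)
      choose h hha hhe using fun l => (e.holAt_iff y hye _).1 (h1 l)
      refine ⟨fun z l => h l z, fun _ => ⟨analyticAt_pi_iff.2 hha, ?_⟩⟩
      filter_upwards [eventually_all.2 hhe] with z hz
      ext l
      exact hz l
    · exact ⟨fun _ => 0, fun h => absurd h hx⟩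
  choose h hh using hh
  have hW : {z | ∀ x ∈ F, AnalyticAt ℂ (h x) z ∧ h x z ∈ (i x).target} ∈ 𝓝 (e.toFun y) := by
    refine (Finset.eventually_all F).2 fun x hx => ?_
    have h1 := (hh x hx).2.eq_of_nhds
    simp only [Function.comp_apply, hsx x hx] at h1
    refine (hh x hx).1.eventually_analyticAt.and ((hh x hx).1.continuousAt.eventually
      ((i x).isOpen_target.mem_nhds ?_))
    rw [← h1]
    exact (i x).mapsTo (hi x)
  -- Equality of germs at every nearby `z` is required, because pullback involves the derivative.
  have hQ : {z | z ∈ O ∧ ∀ x ∈ F, s x z ∈ (i x).source ∧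
      (i x).toFun ∘ s x =ᶠ[𝓝 z] h x ∘ e.toFun} ∈ 𝓝 y := by
    refine Eventually.and (hOo.mem_nhds hyO) ((Finset.eventually_all F).2 fun x hx => ?_)
    refine Eventually.and ?_ (eventually_eventually_nhds.2 (hh x hx).2)
    refine ((S.isIso_section x).continuousOn.continuousAt
      ((S.isIso_section x).eventually_mem (hyV x hx))).eventually
      ((i x).isOpen_source.mem_nhds ?_)
    rw [hsx x hx]
    exact hi x
  obtain ⟨j, hj, hyj, hjs, hjt⟩ := e.exists_restrict hye hQ hW
  have hjta : j.target ⊆ (i a).target := fun z hz => (ht₁ (hjt hz).1).1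
  -- The term at `a` needs no transition map: `e` is its own embedding, so `θ a` enters unchanged
  -- and keeps its strict positivity.
  refine ⟨F.erase a, j, hyj, fun z => θ a z + ∑ x ∈ F.erase a, pullback (h x) (θ x) z, ?_, ?_, ?_⟩
  · refine ((hθ a).mono hjta).add (ContDiffOn.sum fun x hx z hz => ?_)
    obtain ⟨hz1, hz2⟩ := (hjt hz).2 x (Finset.mem_of_mem_erase hx)
    exact (contDiffAt_pullback hz1
      ((hθ x).contDiffAt ((i x).isOpen_target.mem_nhds hz2))).contDiffWithinAt
  · intro m φ t ht hφ
    obtain ⟨hφe, hφO, hφF⟩ := hjs hφ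
    have hval : ∀ x ∈ F, Ω.val m (φ.mapIso (S.isIso_section x)) t =
        pullback ((i x).toFun ∘ s x ∘ φ.toFun) (θ x) t := fun x hx =>
      hr x m (φ.mapIso (S.isIso_section x)) t ⟨ht, hV x hx hφO⟩ (hφF x hx).1
    rw [hη m φ t ht hφO, ← Finset.add_sum_erase F _ ha, pullback_add, pullback_sum]
    congr 1
    · rw [hval a ha, hj, he]
      rfl
    · refine Finset.sum_congr rfl fun x hx => ?_
      have hxF := Finset.mem_of_mem_erase hx
      have hd := analyticAt_embedding_comp_param j φ ht hφ
      have hhd := ((hjt (j.mapsTo hφ)).2 x hxF).1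
      rw [hval x hxF, ← pullback_comp
        (hhd.restrictScalars (𝕜 := ℝ)).differentiableAt (hd.restrictScalars (𝕜 := ℝ)).differentiableAt,
        hj]
      exact pullback_congr ((φ.continuousAt ht).eventually (hφF x hxF).2) (θ x)
  · intro z hz
    -- The description holds at every point of the target, off the image of `Y` as well, as
    -- positivity is demanded there.
    refine ⟨hjta hz, fun x => fderiv ℂ (h x) z, fun x => h x z, fun x hx =>
      ((hjt hz).2 x (Finset.mem_of_mem_erase hx)).2, ?_⟩
    refine congrArg (θ a z + ·) (Finset.sum_congr rfl fun x hx => ?_)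
    rw [pullback, fderiv_real_eq ((hjt hz).2 x (Finset.mem_of_mem_erase hx)).1]

end Push

/-- The trace of the given form is the required form on `Y`. -/
theorem IsBalanced.of_isLocalIsomorphism_of_compactSpace {X Y : Type*} [TopologicalSpace X]
    [ReducedComplexSpace X] [TopologicalSpace Y] [ReducedComplexSpace Y] [CompactSpace X]
    {f : X → Y} (hf : IsLocalIsomorphism f) (hX : IsBalanced X) : IsBalanced Y := by
  obtain ⟨n, hn, Ω, hc, hr, ht, hp⟩ := hX
  obtain ⟨U, V, s, S⟩ := hf.exists_localSections
  have hne : ∀ {y : Y} {F : Finset X}, (F : Set X) = f ⁻¹' {y} → ∃ a, a ∈ F := by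
    intro y F hF
    obtain ⟨a, rfl⟩ := hf.1 y
    exact ⟨a, by rw [← Finset.mem_coe, hF]; rfl⟩
  have hFy : ∀ {y : Y} {F : Finset X}, (F : Set X) = f ⁻¹' {y} → ∀ x ∈ F, f x = y := by
    intro y F hF x hx
    rw [← Finset.mem_coe, hF] at hx
    exact hx
  let T : SmoothForm Y ((n - 1) + (n - 1)) :=
    { val := traceVal f s Ω
      exists_extension := by
        intro y
        obtain ⟨F, hF, O, hOo, hyO, hV, hO⟩ := S.exists_fiber_nhds y
        obtain ⟨a, ha⟩ := hne hF
        choose N i hi θ hθ hres using Ω.exists_extension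
        obtain ⟨-, j, hj, θ', hθ', hres', -⟩ := exists_trace_restriction S Ω (hFy hF) hOo hyO hV
          (fun m φ t ht hφ => traceVal_eq_sum S Ω hV hO φ ht hφ) hi hθ hres ha
        exact ⟨N a, j, hj, θ', hθ', hres'⟩ }
  -- Near `t` the trace is a finite sum of expressions of `Ω` in parametrizations of `X`;
  -- closedness, reality and type follow termwise.
  have hT : ∀ (m : ℕ) (φ : RegularParam Y m), ∀ t ∈ φ.source, ∃ (F : Finset X)
      (ψ : X → RegularParam X m), (∀ x ∈ F, t ∈ (ψ x).source) ∧
        T.val m φ =ᶠ[𝓝 t] fun t' => ∑ x ∈ F, Ω.val m (ψ x) t' := by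
    intro m φ t hts
    obtain ⟨F, hF, O, hOo, hyO, hV, hO⟩ := S.exists_fiber_nhds (φ.toFun t)
    refine ⟨F, fun x => φ.mapIso (S.isIso_section x), fun x hx => ⟨hts, hV x hx hyO⟩, ?_⟩
    filter_upwards [φ.isOpen_source.mem_nhds hts,
      (φ.continuousAt hts).preimage_mem_nhds (hOo.mem_nhds hyO)] with t' ht' htO
    exact traceVal_eq_sum S Ω hV hO φ ht' htO
  refine ⟨n, (hasDimension_iff_of_isLocalIsomorphism hf).1 hn, T, ?_, ?_, ?_, ?_⟩
  · intro m φ t hts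
    obtain ⟨F, ψ, hψ, e⟩ := hT m φ t hts
    rw [e.extDeriv_eq]
    exact extDeriv_sum_eq_zero F _
      (fun x hx => (Ω.contDiffAt_val (ψ x) (hψ x hx)).differentiableAt (by simp))
      fun x hx => hc m (ψ x) t (hψ x hx)
  · intro m φ t hts v
    obtain ⟨F, ψ, hψ, e⟩ := hT m φ t hts
    rw [e.eq_of_nhds, ContinuousAlternatingMap.sum_apply, map_sum]
    exact Finset.sum_congr rfl fun x hx => hr m (ψ x) t (hψ x hx) v
  · intro m φ t hts
    obtain ⟨F, ψ, hψ, e⟩ := hT m φ t hts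
    refine ⟨rfl, fun c v => ?_⟩
    rw [e.eq_of_nhds, ContinuousAlternatingMap.sum_apply, ContinuousAlternatingMap.sum_apply,
      Finset.mul_sum]
    exact Finset.sum_congr rfl fun x hx => (ht m (ψ x) t (hψ x hx)).2 c v
  · intro y
    obtain ⟨F, hF, O, hOo, hyO, hV, hO⟩ := S.exists_fiber_nhds y
    obtain ⟨a, ha⟩ := hne hF
    -- The extensions now come from strict positivity of `Ω`, so each `θ x` is positive on its whole
    -- target.
    choose N i hi θ hθ hpos hres using hp
    obtain ⟨G, j, hj, θ', hθ', hres', hval⟩ := exists_trace_restriction S Ω (hFy hF) hOo hyO hV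
      (fun m φ t ht hφ => traceVal_eq_sum S Ω hV hO φ ht hφ) hi hθ hres ha
    refine ⟨N a, j, hj, θ', hθ', fun z hz => ?_, hres'⟩
    obtain ⟨hza, B, w, hw, hθz⟩ := hval z hz
    rw [hθz]
    exact (hpos a z hza).add_sum_compContinuousLinearMap G (fun x => θ x (w x))
      (fun x hx => hpos x (w x) (hw x hx)) B

end BalancedSpace

end

theorem proposition4p8 {X : Type*} {Y : Type*}
    [TopologicalSpace X] [CompactSpace X] [BalancedSpace.ReducedComplexSpace X]
    [TopologicalSpace Y] [CompactSpace Y] [BalancedSpace.ReducedComplexSpace Y]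
    (f : X → Y) :
    (BalancedSpace.IsLocalIsomorphism f →
      BalancedSpace.IsBalanced Y → BalancedSpace.IsBalanced X) ∧
    (BalancedSpace.IsUnramifiedCovering f →
      (BalancedSpace.IsBalanced X ↔ BalancedSpace.IsBalanced Y)) :=
  ⟨fun hf hY => hY.of_isLocalIsomorphism hf, fun hf =>
    ⟨fun hX => hX.of_isLocalIsomorphism_of_compactSpace hf.2, fun hY =>
      hY.of_isLocalIsomorphism hf.2⟩⟩
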